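/- Let $F=(F_1,\dots,F_m):\mathbb{R}^n\to\mathbb{R}^m$, $m\ge 1$, be twice continuously differentiable, and let $\|\cdot\|$ be the Euclidean norm (and the induced operator norm). Put $\mathcal{D}(x,d)=\max_{j}\nabla F_j(x)^\top d$ and $\Delta_m=\{\mu\in\mathbb{R}^m:\mu_j\ge 0,\ \sum_j\mu_j=1\}$. A point $x$ is Pareto critical if there is no $d\in\mathbb{R}^n$ with $\nabla F_j(x)^\top d<0$ for all $j$; it is local Pareto optimal if it has a neighborhood containing no $y$ with $F_j(y)\le F_j(x)$ for all $j$ and $F(y)\ne F(x)$. Algorithm. Let $\rho\in(0,1/2)$, $\sigma\in(\rho,1)$, $0<\underline\vartheta\le\bar\vartheta$, $x^0\in\mathbb{R}^n$ and symmetric positive definite matrices $B_1^0,\dots,B_m^0\in\mathbb{R}^{n\times n}$ be given. For $k=0,1,2,\dots$: 1. Let $d^k\in\arg\min_{d\in\mathbb{R}^n}\max_{j}\big(\nabla F_j(x^k)^\top d+\tfrac12 d^\top B_j^k d\big)$. 2. Stop if $x^k$ is Pareto critical. 3. Choose $\alpha_k>0$ satisfying the multiobjective Wolfe conditions at $\alpha=\alpha_k$,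 $$F_j(x^k+\alpha d^k)\le F_j(x^k)+\rho\,\alpha\,\mathcal{D}(x^k,d^k)\ \ (j=1,\dots,m),\qquad \mathcal{D}(x^k+\alpha d^k,d^k)\ge\sigma\,\mathcal{D}(x^k,d^k),$$ taking $\alpha_k=1$ whenever $\alpha=1$ satisfies them, and set $x^{k+1}=x^k+\alpha_kd^k$. 4. Let $s^k=x^{k+1}-x^k$, $y_j^k=\nabla F_j(x^{k+1})-\nabla F_j(x^k)$ and $\eta_j^k=(y_j^k)^\top s^k/\|s^k\|^2$. Choose $\mu^k\in\Delta_m$ and $\vartheta_k\in(\underline\vartheta,\bar\vartheta)$, and let $$r_j^k=\max\{-\eta_j^k,0\}+\vartheta_k\Big\|\sum_{i=1}^m\mu_i^k\nabla F_i(x^k)\Big\|,\qquad \gamma_j^k=y_j^k+r_j^ks^k .$$ 5. Let $$B_j^{k+1}=B_j^k-\frac{B_j^ks^k(s^k)^\top B_j^k}{(s^k)^\top B_j^ks^k}+\frac{\gamma_j^k(\gamma_j^k)^\top}{(\gamma_j^k)^\top s^k}\qquad(j=1,\dots,m).$$ Theorem. Let $\{x^k\}$ be an infinite sequence generated by the Algorithm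 (so that no $x^k$ is Pareto critical). Suppose that (a) $\{x^k\}$ converges to a local Pareto optimal point $x^*$ at which $\nabla^2F_j(x^*)$ is positive definite for all $j=1,\dots,m$; (b) there are $\nu\in(0,1]$ and $M>0$ such that $\|\nabla^2F_j(x)-\nabla^2F_j(x^*)\|\le M\|x-x^*\|^\nu$ for all $j=1,\dots,m$ and all $x$ in a neighborhood of $x^*$; (c) $\sum_{k\ge0}r_j^k<\infty$ for each $j=1,\dots,m$. Then for all sufficiently large $k$ the step size $\alpha=1$ satisfies the multiobjective Wolfe conditions of step 3, and $\{x^k\}$ converges to $x^*$ superlinearly: $x^k\ne x^*$ for all $k$ and $$\lim_{k\to\infty}\frac{\|x^{k+1}-x^*\|}{\|x^k-x^*\|}=0 .$$ -/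

import Mathlib

open Filter Topology Matrix

noncomputable section

namespace MOBFGS

/-- `ℝⁿ` with the Euclidean norm. -/
abbrev Vec (n : ℕ) := EuclideanSpace ℝ (Fin n)

variable {n m : ℕ}

/-- The gradient `∇F_j(x)` of the `j`-th component of `F`. -/
def grad (F : Vec n → Vec m) (j : Fin m) (x : Vec n) : Vec n :=
  gradient (fun y => F y j) x

/-- The Hessian `∇²F_j(x)`, as the linear operator `z ↦ ∇²F_j(x) z` (the derivative of the
gradient); its norm is the operator norm. -/
def hess (F : Vec n → Vec m) (j : Fin m) (x : Vec n) : Vec n →L[ℝ] Vec n :=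
  fderiv ℝ (grad F j) x

/-- `x` is Pareto critical: `-(ℝ^m_{++}) ∩ Image(JF(x)) = ∅`. -/
def ParetoCritical (F : Vec n → Vec m) (x : Vec n) : Prop :=
  {v : Vec m | ∀ j, v j < 0} ∩ Set.range (fderiv ℝ F x) = ∅

/-- `x'` is a local Pareto optimal point: on some neighbourhood `U` of `x'` there is no `x` with
`F(x) ≤ F(x')` componentwise and `F(x) ≠ F(x')`. -/
def LocalParetoOptimal (F : Vec n → Vec m) (x' : Vec n) : Prop :=
  ∃ U ∈ 𝓝 x', ¬ ∃ x ∈ U, (∀ j, F x j ≤ F x' j) ∧ F x ≠ F x'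

/-- `𝒟(x,d) = max_j ∇F_j(x)ᵀ d` (a maximum over a finite index set, non-empty when `0 < m`). -/
def maxDirDeriv (F : Vec n → Vec m) (x d : Vec n) : ℝ :=
  ⨆ j : Fin m, inner ℝ (grad F j x) d

/-- The objective `d ↦ max_j (∇F_j(x)ᵀ d + ½ dᵀ B_j d)` of the direction subproblem. -/
def qnModel (F : Vec n → Vec m) (B : Fin m → Matrix (Fin n) (Fin n) ℝ) (x d : Vec n) : ℝ :=
  ⨆ j : Fin m, (inner ℝ (grad F j x) d + 1 / 2 * (d.ofLp ⬝ᵥ (B j *ᵥ d.ofLp)))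

/-- The step size `a` satisfies the multiobjective Wolfe conditions at `x` along `d`. -/
def Wolfe (F : Vec n → Vec m) (ρ σ : ℝ) (x d : Vec n) (a : ℝ) : Prop :=
  (∀ j, F (x + a • d) j ≤ F x j + ρ * a * maxDirDeriv F x d) ∧
    maxDirDeriv F (x + a • d) d ≥ σ * maxDirDeriv F x d

/-- `η_j = y_jᵀ s / ‖s‖²`, for a step from `x` to `x₁`, where `s = x₁ - x` and
`y_j = ∇F_j(x₁) - ∇F_j(x)`. -/
def eta (F : Vec n → Vec m) (j : Fin m) (x x₁ : Vec n) : ℝ :=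
  inner ℝ (grad F j x₁ - grad F j x) (x₁ - x) / ‖x₁ - x‖ ^ 2

/-- `r_j = max {-η_j, 0} + ϑ ‖∑ i, μ_i ∇F_i(x)‖`. -/
def corr (F : Vec n → Vec m) (μ : Fin m → ℝ) (ϑ : ℝ) (j : Fin m) (x x₁ : Vec n) : ℝ :=
  max (-eta F j x x₁) 0 + ϑ * ‖∑ i, μ i • grad F i x‖

/-- `γ_j = y_j + r_j s`. -/
def gam (F : Vec n → Vec m) (μ : Fin m → ℝ) (ϑ : ℝ) (j : Fin m) (x x₁ : Vec n) : Vec n :=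
  (grad F j x₁ - grad F j x) + corr F μ ϑ j x x₁ • (x₁ - x)

/-- The BFGS update `B - (B s sᵀ B) / (sᵀ B s) + (γ γᵀ) / (γᵀ s)`. -/
def bfgsUpdate (B : Matrix (Fin n) (Fin n) ℝ) (s γ : Vec n) : Matrix (Fin n) (Fin n) ℝ :=
  B - (s.ofLp ⬝ᵥ (B *ᵥ s.ofLp))⁻¹ • (B * vecMulVec s.ofLp s.ofLp * B)
    + (γ.ofLp ⬝ᵥ s.ofLp)⁻¹ • vecMulVec γ.ofLp γ.ofLp

/-- The sequences of an infinite run of the modified BFGS algorithm for `F`, with parameters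
`ρ, σ, ϑlo, ϑhi`: iterates `x`, directions `d`, step sizes `α`, multipliers `μ`, scalars `ϑ`, and
matrices `B k j` (iteration `k`, objective `j`). The run starts at `x 0`. -/
structure IsRun (F : Vec n → Vec m) (ρ σ ϑlo ϑhi : ℝ) (x d : ℕ → Vec n) (α : ℕ → ℝ)
    (μ : ℕ → Fin m → ℝ) (ϑ : ℕ → ℝ) (B : ℕ → Fin m → Matrix (Fin n) (Fin n) ℝ) : Prop where
  rho_pos : 0 < ρ
  rho_lt : ρ < 1 / 2
  rho_lt_sigma : ρ < σ
  sigma_lt : σ < 1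
  lo_pos : 0 < ϑlo
  lo_le_hi : ϑlo ≤ ϑhi
  init_posDef : ∀ j, (B 0 j).PosDef
  /-- `d^k` minimizes the quasi-Newton model at `x^k`. -/
  direction : ∀ k, IsMinOn (qnModel F (B k) (x k)) Set.univ (d k)
  /-- The stopping criterion is never met. -/
  not_critical : ∀ k, ¬ ParetoCritical F (x k)
  step_pos : ∀ k, 0 < α k
  step_wolfe : ∀ k, Wolfe F ρ σ (x k) (d k) (α k)
  /-- The unit step is tried first, so it is taken whenever it is admissible. -/
  unit_first : ∀ k, Wolfe F ρ σ (x k) (d k) 1 → α k = 1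
  next_iterate : ∀ k, x (k + 1) = x k + α k • d k
  multiplier : ∀ k, μ k ∈ stdSimplex ℝ (Fin m)
  scalar_mem : ∀ k, ϑ k ∈ Set.Ioo ϑlo ϑhi
  next_matrix : ∀ k j, B (k + 1) j =
    bfgsUpdate (B k j) (x (k + 1) - x k) (gam F (μ k) (ϑ k) j (x k) (x (k + 1)))

/-- `x k → x'` at a (Q-)superlinear rate. -/
def ConvergesSuperlinearly (x : ℕ → Vec n) (x' : Vec n) : Prop :=
  Tendsto x atTop (𝓝 x') ∧ (∀ k, x k ≠ x') ∧
    Tendsto (fun k => ‖x (k + 1) - x'‖ / ‖x k - x'‖) atTop (𝓝 0)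

end MOBFGS

end

/-! Write `G_j` for the Hessian of `F_j` at the limit. The Byrd–Nocedal potential `tr (G_j⁻¹ B_j) -
log det (G_j⁻¹ B_j)` is nonnegative, and a BFGS update lowers it by a gain and raises it by a
curvature term (`bfgsPotential_update`). The gain is at least 1, and its excess over 1 controls
`‖B_j s - G_j s‖²` (`exists_residual_le_of_bfgsGain_le`). The curvature term is at most `1 + C ε²`
when `‖γ_j - G_j s‖ ≤ ε ‖s‖` (`exists_curvature_error_le`). All objectives share the step `s`, so
summing over `j` gives `Ψ_{k+1} ≤ Ψ_k - Γ_k + C ε²`, where `Γ_k` is the total excess gain.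

The inequality is used twice. With `ε` merely small, an iteration with `Γ_k ≤ 1` contracts the
smallest gap `F_j(x^k) - F_j(x*)` by a fixed factor, and any other iteration is paid for by the drop
of `Ψ`. This yields R-linear convergence (`exists_linear_rate`). The linear rate, the Hölder bound
and the summable corrections then make the deviations summable, so that `Ψ` stays bounded and `Γ_k →
0`. Boundedness of `Ψ` keeps every `B_j` uniformly positive definite; `Γ_k → 0` is the Dennis–Moré
condition along `d^k` for all objectives at once.

The Dennis–Moré condition makes the model accurate to second order along `d^k`, hence unit steps are
accepted (`eventually_wolfe_one`). The multipliers of subproblem `k` make a convex combination of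
the gradients at `x^{k+1}` of size `o(‖d^k‖)`, which forces `‖d^{k+1}‖ = o(‖d^k‖)`
(`eventually_norm_dir_succ_le`) and superlinear convergence. -/

noncomputable section

namespace MOBFGS

/-! ### Trace, determinant and definiteness of the BFGS update -/

section BFGSAlgebra

variable {n : ℕ}

lemma dotProduct_mulVec_comm {B : Matrix (Fin n) (Fin n) ℝ} (hB : B.IsHermitian)
    (x y : Fin n → ℝ) : x ⬝ᵥ (B *ᵥ y) = y ⬝ᵥ (B *ᵥ x) := by
  have h : Bᵀ = B := by simpa [Matrix.IsHermitian] using hB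
  rw [dotProduct_mulVec, ← mulVec_transpose, h, dotProduct_comm]

lemma dotProduct_mulVec_sq_le {B : Matrix (Fin n) (Fin n) ℝ} (hB : B.PosSemidef)
    (x y : Fin n → ℝ) : (x ⬝ᵥ (B *ᵥ y)) ^ 2 ≤ (x ⬝ᵥ (B *ᵥ x)) * (y ⬝ᵥ (B *ᵥ y)) := by
  have h := LinearMap.BilinForm.apply_mul_apply_le_of_forall_zero_le (Matrix.toBilin' B)
    (fun x => by
      rw [Matrix.toBilin'_apply']
      simpa using hB.dotProduct_mulVec_nonneg x) x y
  simp only [Matrix.toBilin'_apply'] at h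
  rw [dotProduct_mulVec_comm hB.isHermitian y x] at h
  rw [sq]; exact h

lemma posDef_dotProduct_pos {B : Matrix (Fin n) (Fin n) ℝ} (hB : B.PosDef)
    {x : Fin n → ℝ} (hx : x ≠ 0) : 0 < x ⬝ᵥ (B *ᵥ x) := by
  simpa using hB.dotProduct_mulVec_pos hx

lemma posSemidef_dotProduct_nonneg {B : Matrix (Fin n) (Fin n) ℝ} (hB : B.PosSemidef)
    (x : Fin n → ℝ) : 0 ≤ x ⬝ᵥ (B *ᵥ x) := by
  simpa using hB.dotProduct_mulVec_nonneg x

lemma bfgsUpdate_eq {B : Matrix (Fin n) (Fin n) ℝ} (hB : B.IsHermitian) (s γ : Vec n) :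
    bfgsUpdate B s γ = B - (s.ofLp ⬝ᵥ (B *ᵥ s.ofLp))⁻¹ • vecMulVec (B *ᵥ s.ofLp) (B *ᵥ s.ofLp)
      + (γ.ofLp ⬝ᵥ s.ofLp)⁻¹ • vecMulVec γ.ofLp γ.ofLp := by
  have h : Bᵀ = B := by simpa [Matrix.IsHermitian] using hB
  rw [bfgsUpdate, mul_vecMulVec, vecMulVec_mul, ← mulVec_transpose, h]

lemma trace_mul_bfgsUpdate {B : Matrix (Fin n) (Fin n) ℝ} (hB : B.IsHermitian)
    (H : Matrix (Fin n) (Fin n) ℝ) (s γ : Vec n) :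
    (H * bfgsUpdate B s γ).trace = (H * B).trace
      - ((B *ᵥ s.ofLp) ⬝ᵥ (H *ᵥ (B *ᵥ s.ofLp))) / (s.ofLp ⬝ᵥ (B *ᵥ s.ofLp))
      + (γ.ofLp ⬝ᵥ (H *ᵥ γ.ofLp)) / (γ.ofLp ⬝ᵥ s.ofLp) := by
  rw [bfgsUpdate_eq hB]
  simp only [mul_add, mul_sub, trace_add, trace_sub, Matrix.mul_smul, trace_smul, mul_vecMulVec,
    trace_vecMulVec, smul_eq_mul]
  rw [dotProduct_comm (H *ᵥ (B *ᵥ s.ofLp)), dotProduct_comm (H *ᵥ γ.ofLp)]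
  ring

/-- The update is `B (1 + U V)` with `U V` of rank at most two, so Sylvester's identity reduces the
determinant to a 2 × 2 one. -/
lemma det_bfgsUpdate {B : Matrix (Fin n) (Fin n) ℝ} (hB : B.PosDef) (s γ : Vec n)
    (hs : s.ofLp ⬝ᵥ (B *ᵥ s.ofLp) ≠ 0) (hγ : γ.ofLp ⬝ᵥ s.ofLp ≠ 0) :
    (bfgsUpdate B s γ).det =
      B.det * ((γ.ofLp ⬝ᵥ s.ofLp) / (s.ofLp ⬝ᵥ (B *ᵥ s.ofLp))) := by
  have hdet : IsUnit B.det := hB.det_pos.ne'.isUnit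
  set u := B *ᵥ s.ofLp with hu
  set q := s.ofLp ⬝ᵥ u with hq
  set p := γ.ofLp ⬝ᵥ s.ofLp with hp
  let w : Fin n → ℝ := B⁻¹ *ᵥ γ.ofLp
  have hBw : B *ᵥ w = γ.ofLp := by
    simp only [w, mulVec_mulVec, mul_nonsing_inv _ hdet, one_mulVec]
  let U : Matrix (Fin n) (Fin 2) ℝ := of fun i j => ![-q⁻¹ * s.ofLp i, p⁻¹ * w i] j
  let V : Matrix (Fin 2) (Fin n) ℝ := of ![u, γ.ofLp]
  have hfac : bfgsUpdate B s γ = B * (1 + U * V) := by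
    have hUV : U * V = -(q⁻¹ • vecMulVec s.ofLp u) + p⁻¹ • vecMulVec w γ.ofLp := by
      ext i j
      simp [U, V, mul_apply, Fin.sum_univ_two, vecMulVec_apply]
      ring
    rw [bfgsUpdate_eq hB.isHermitian, hUV, mul_add, mul_add, mul_neg, Matrix.mul_smul, Matrix.mul_smul,
      mul_vecMulVec, mul_vecMulVec, hBw, mul_one, ← hu]
    abel
  have huw : u ⬝ᵥ w = p := by
    rw [dotProduct_comm, hu, dotProduct_mulVec_comm hB.isHermitian, hBw, dotProduct_comm]
  have hdet2 : (1 + V * U).det = p / q := by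
    -- This entry cancels against the identity, so only the off-diagonal product survives in the 2 ×
    -- 2 determinant.
    have h00 : (V * U) 0 0 = -1 := by
      have : (V * U) 0 0 = -q⁻¹ * (u ⬝ᵥ s.ofLp) := by
        simp [U, V, mul_apply, dotProduct, Finset.mul_sum]
        refine Finset.sum_congr rfl fun i _ => by ring
      rw [this, dotProduct_comm, ← hq]; field_simp
    have h01 : (V * U) 0 1 = 1 := by
      have : (V * U) 0 1 = p⁻¹ * (u ⬝ᵥ w) := by
        simp [U, V, mul_apply, dotProduct, Finset.mul_sum]
        refine Finset.sum_congr rfl fun i _ => by ring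
      rw [this, huw]; field_simp
    have h10 : (V * U) 1 0 = -p / q := by
      have : (V * U) 1 0 = -q⁻¹ * (γ.ofLp ⬝ᵥ s.ofLp) := by
        simp [U, V, mul_apply, dotProduct, Finset.mul_sum]
        refine Finset.sum_congr rfl fun i _ => by ring
      rw [this, ← hp]; ring
    rw [det_fin_two]
    simp [Matrix.add_apply, h00, h01, h10]
    ring
  rw [hfac, det_mul, det_one_add_mul_comm, hdet2]

/-- Cauchy–Schwarz for the form `B` gives semidefiniteness; the nonzero determinant upgrades it. -/
lemma bfgsUpdate_posDef {B : Matrix (Fin n) (Fin n) ℝ} (hB : B.PosDef) {s γ : Vec n}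
    (hs : s ≠ 0) (hγ : 0 < γ.ofLp ⬝ᵥ s.ofLp) : (bfgsUpdate B s γ).PosDef := by
  have hs' : s.ofLp ≠ 0 := fun h => hs (by ext i; simp [h])
  have hq := posDef_dotProduct_pos hB hs'
  have hsymm : Bᵀ = B := by simpa [Matrix.IsHermitian] using hB.isHermitian
  have hpsd : (bfgsUpdate B s γ).PosSemidef := by
    refine PosSemidef.of_dotProduct_mulVec_nonneg ?_ fun z => ?_
    · rw [bfgsUpdate_eq hB.isHermitian]
      simp [Matrix.IsHermitian, hsymm, transpose_vecMulVec]
    · rw [bfgsUpdate_eq hB.isHermitian]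
      simp only [star_trivial, add_mulVec, sub_mulVec, smul_mulVec, vecMulVec_mulVec,
        dotProduct_add, dotProduct_sub, dotProduct_smul, smul_eq_mul, op_smul_eq_smul]
      have hcs := dotProduct_mulVec_sq_le hB.posSemidef z s.ofLp
      have h1 : (s.ofLp ⬝ᵥ (B *ᵥ s.ofLp))⁻¹ * (z ⬝ᵥ (B *ᵥ s.ofLp)) ^ 2 ≤ z ⬝ᵥ (B *ᵥ z) := by
        rw [inv_mul_le_iff₀ hq]; linarith
      have h2 : 0 ≤ (γ.ofLp ⬝ᵥ s.ofLp)⁻¹ * (z ⬝ᵥ γ.ofLp) ^ 2 := by positivity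
      rw [dotProduct_comm (B *ᵥ s.ofLp) z, dotProduct_comm γ.ofLp z]
      nlinarith
  refine hpsd.posDef_iff_isUnit.2 ?_
  rw [isUnit_iff_isUnit_det, det_bfgsUpdate hB s γ hq.ne' hγ.ne']
  have := hB.det_pos
  exact (by positivity : (0:ℝ) < _).ne'.isUnit

end BFGSAlgebra

/-! ### The Byrd–Nocedal potential and its change under an update -/

section Potential

variable {n : ℕ}

/-- The Byrd–Nocedal potential `tr (H B) - log det (H B)`. -/
def bfgsPotential (H B : Matrix (Fin n) (Fin n) ℝ) : ℝ := (H * B).trace - Real.log (H * B).det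

lemma one_le_sub_log {t : ℝ} (ht : 0 < t) : 1 ≤ t - Real.log t := by
  linarith [Real.log_le_sub_one_of_pos ht]

lemma trace_sub_log_det_eq_sum {A : Matrix (Fin n) (Fin n) ℝ} (hA : A.PosDef) :
    A.trace - Real.log A.det = ∑ i, (hA.1.eigenvalues i - Real.log (hA.1.eigenvalues i)) := by
  rw [hA.1.trace_eq_sum_eigenvalues, hA.1.det_eq_prod_eigenvalues, Finset.sum_sub_distrib]
  simp only [RCLike.ofReal_real_eq_id, id]
  rw [Real.log_prod fun i _ => (hA.eigenvalues_pos i).ne']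

lemma dotProduct_eq_inner (x y : Fin n → ℝ) :
    x ⬝ᵥ y = inner ℝ (WithLp.toLp 2 x : Vec n) (WithLp.toLp 2 y) := by
  simp [EuclideanSpace.inner_eq_star_dotProduct, dotProduct_comm]

/-- The potential is the sum of `λ - log λ` over the eigenvalues. The summands are nonnegative, so
each is at most `K`, and `λ > 0` then forces `log λ ≥ -K`. -/
lemma exp_neg_mul_le_dotProduct {A : Matrix (Fin n) (Fin n) ℝ} (hA : A.PosDef) {K : ℝ}
    (hK : A.trace - Real.log A.det ≤ K) (z : Fin n → ℝ) :
    Real.exp (-K) * (z ⬝ᵥ z) ≤ z ⬝ᵥ (A *ᵥ z) := by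
  have hev : ∀ i, Real.exp (-K) ≤ hA.1.eigenvalues i := fun i => by
    have hpos := hA.eigenvalues_pos i
    rw [trace_sub_log_det_eq_sum hA] at hK
    have := Finset.single_le_sum (f := fun i => hA.1.eigenvalues i
      - Real.log (hA.1.eigenvalues i)) (fun j _ =>
        zero_le_one.trans (one_le_sub_log (hA.eigenvalues_pos j))) (Finset.mem_univ i)
    rw [← Real.le_log_iff_exp_le hpos]
    linarith
  have hin : ∀ w : Fin n → ℝ, z ⬝ᵥ w =
      ∑ i, (z ⬝ᵥ (hA.1.eigenvectorBasis i).ofLp) * ((hA.1.eigenvectorBasis i).ofLp ⬝ᵥ w) := by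
    intro w
    rw [dotProduct_eq_inner, ← hA.1.eigenvectorBasis.sum_inner_mul_inner]
    simp only [dotProduct_eq_inner]
  rw [hin z, hin (A *ᵥ z), Finset.mul_sum]
  refine Finset.sum_le_sum fun i _ => ?_
  rw [dotProduct_mulVec_comm hA.1, hA.1.mulVec_eigenvectorBasis, dotProduct_smul,
    dotProduct_comm _ z, smul_eq_mul]
  nlinarith [hev i, mul_self_nonneg (z ⬝ᵥ (hA.1.eigenvectorBasis i).ofLp)]

lemma exists_pos_mul_le_dotProduct {A : Matrix (Fin n) (Fin n) ℝ} (hA : A.PosDef) :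
    ∃ c > 0, ∀ z : Fin n → ℝ, c * (z ⬝ᵥ z) ≤ z ⬝ᵥ (A *ᵥ z) :=
  ⟨_, Real.exp_pos _, exp_neg_mul_le_dotProduct hA le_rfl⟩

lemma exists_dotProduct_le_mul (A : Matrix (Fin n) (Fin n) ℝ) :
    ∃ C > 0, ∀ z : Fin n → ℝ, z ⬝ᵥ (A *ᵥ z) ≤ C * (z ⬝ᵥ z) := by
  let T := Matrix.toEuclideanCLM (n := Fin n) (𝕜 := ℝ) A
  refine ⟨‖T‖ + 1, by positivity, fun z => ?_⟩
  have h1 : z ⬝ᵥ (A *ᵥ z) = inner ℝ (WithLp.toLp 2 z : Vec n) (T (WithLp.toLp 2 z)) := by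
    rw [dotProduct_eq_inner, Matrix.toEuclideanCLM_toLp]
  rw [h1, dotProduct_eq_inner, real_inner_self_eq_norm_sq]
  have h2 := real_inner_le_norm (WithLp.toLp 2 z : Vec n) (T (WithLp.toLp 2 z))
  have h3 := T.le_opNorm (WithLp.toLp 2 z)
  nlinarith [norm_nonneg (WithLp.toLp 2 z : Vec n)]

lemma exists_transpose_mul_self {H : Matrix (Fin n) (Fin n) ℝ} (hH : H.PosDef) :
    ∃ R : Matrix (Fin n) (Fin n) ℝ, H = Rᵀ * R ∧ IsUnit R.det := by
  open scoped MatrixOrder in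
  obtain ⟨R, hR⟩ := CStarAlgebra.nonneg_iff_eq_star_mul_self.mp hH.posSemidef.nonneg
  have hR' : H = Rᵀ * R := by simpa [star_eq_conjTranspose] using hR
  refine ⟨R, hR', ?_⟩
  have := hH.det_pos
  rw [hR', det_mul, det_transpose] at this
  exact (by rintro h; simp [h] at this : R.det ≠ 0).isUnit

lemma posDef_mul_mul_transpose {B R : Matrix (Fin n) (Fin n) ℝ} (hB : B.PosDef)
    (hR : IsUnit R.det) : (R * B * Rᵀ).PosDef := by
  have := hB.mul_mul_conjTranspose_same (B := R)
    (vecMul_injective_iff_isUnit.2 ((isUnit_iff_isUnit_det R).2 hR))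
  simpa using this

/-- `H * B` need not be symmetric; passing to the congruent matrix `R B Rᵀ` makes the spectral
argument available. -/
lemma bfgsPotential_transpose_mul_self (R B : Matrix (Fin n) (Fin n) ℝ) :
    bfgsPotential (Rᵀ * R) B = (R * B * Rᵀ).trace - Real.log (R * B * Rᵀ).det := by
  rw [bfgsPotential, Matrix.mul_assoc, trace_mul_comm]
  simp only [det_mul]
  ring_nf

lemma bfgsPotential_nonneg {H B : Matrix (Fin n) (Fin n) ℝ} (hH : H.PosDef) (hB : B.PosDef) :
    0 ≤ bfgsPotential H B := by
  obtain ⟨R, rfl, hR⟩ := exists_transpose_mul_self hH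
  have hA := posDef_mul_mul_transpose hB hR
  rw [bfgsPotential_transpose_mul_self, trace_sub_log_det_eq_sum hA]
  exact Finset.sum_nonneg fun i _ => zero_le_one.trans (one_le_sub_log (hA.eigenvalues_pos i))

lemma exists_pos_mul_le_of_bfgsPotential_le {H : Matrix (Fin n) (Fin n) ℝ} (hH : H.PosDef)
    (K : ℝ) : ∃ c > 0, ∀ B : Matrix (Fin n) (Fin n) ℝ, B.PosDef → bfgsPotential H B ≤ K →
      ∀ z : Fin n → ℝ, c * (z ⬝ᵥ z) ≤ z ⬝ᵥ (B *ᵥ z) := by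
  obtain ⟨R, rfl, hR⟩ := exists_transpose_mul_self hH
  obtain ⟨C, hC, hCb⟩ := exists_dotProduct_le_mul (R * Rᵀ)
  refine ⟨Real.exp (-K) / C, by positivity, fun B hB hBK z => ?_⟩
  rw [bfgsPotential_transpose_mul_self] at hBK
  have hA := posDef_mul_mul_transpose hB hR
  let y := (Rᵀ)⁻¹ *ᵥ z
  have hy : Rᵀ *ᵥ y = z := by
    simp only [y, mulVec_mulVec]
    rw [mul_nonsing_inv _ (by rwa [det_transpose]), one_mulVec]
  have h1 := exp_neg_mul_le_dotProduct hA hBK y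
  have h2 := hCb y
  have hmv : ∀ w, y ⬝ᵥ (R *ᵥ w) = z ⬝ᵥ w := fun w => by
    rw [dotProduct_mulVec, ← mulVec_transpose, hy]
  rw [Matrix.mul_assoc, ← mulVec_mulVec, ← mulVec_mulVec, hmv, hy] at h1
  rw [← mulVec_mulVec, hmv, hy] at h2
  calc Real.exp (-K) / C * (z ⬝ᵥ z) ≤ Real.exp (-K) / C * (C * (y ⬝ᵥ y)) := by gcongr
    _ = Real.exp (-K) * (y ⬝ᵥ y) := by field_simp
    _ ≤ _ := h1

/-- The decrease of the potential in one BFGS step, apart from the contribution of `γ`. -/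
def bfgsGain (G B : Matrix (Fin n) (Fin n) ℝ) (s : Vec n) : ℝ :=
  (B *ᵥ s.ofLp) ⬝ᵥ (G⁻¹ *ᵥ (B *ᵥ s.ofLp)) / (s.ofLp ⬝ᵥ (B *ᵥ s.ofLp))
    - Real.log (s.ofLp ⬝ᵥ (B *ᵥ s.ofLp) / s.ofLp ⬝ᵥ (G *ᵥ s.ofLp))

/-- The term `log (sᵀ G s)` is added and subtracted so that gain and curvature term both equal 1 in
the ideal case `B s = G s = γ`. -/
lemma bfgsPotential_update {G B : Matrix (Fin n) (Fin n) ℝ} (hG : G.PosDef) (hB : B.PosDef)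
    {s γ : Vec n} (hs : s ≠ 0) (hγ : 0 < γ.ofLp ⬝ᵥ s.ofLp) :
    bfgsPotential G⁻¹ (bfgsUpdate B s γ) = bfgsPotential G⁻¹ B - bfgsGain G B s
      + ((γ.ofLp ⬝ᵥ (G⁻¹ *ᵥ γ.ofLp)) / (γ.ofLp ⬝ᵥ s.ofLp)
        - Real.log (γ.ofLp ⬝ᵥ s.ofLp / s.ofLp ⬝ᵥ (G *ᵥ s.ofLp))) := by
  have hs' : s.ofLp ≠ 0 := fun h => hs (by ext i; simp [h])
  have hq := posDef_dotProduct_pos hB hs'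
  have hτ := posDef_dotProduct_pos hG hs'
  have hd : (G⁻¹ * B).det ≠ 0 := by
    rw [det_mul]; exact (mul_pos hG.inv.det_pos hB.det_pos).ne'
  have hdet : (G⁻¹ * bfgsUpdate B s γ).det =
      (G⁻¹ * B).det * ((γ.ofLp ⬝ᵥ s.ofLp) / (s.ofLp ⬝ᵥ (B *ᵥ s.ofLp))) := by
    rw [det_mul, det_bfgsUpdate hB s γ hq.ne' hγ.ne', det_mul, mul_assoc]
  rw [bfgsPotential, bfgsPotential, bfgsGain, trace_mul_bfgsUpdate hB.isHermitian, hdet,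
    Real.log_mul hd (div_pos hγ hq).ne', Real.log_div hγ.ne' hq.ne', Real.log_div hq.ne' hτ.ne',
    Real.log_div hγ.ne' hτ.ne']
  ring

end Potential

/-! ### Quantitative bounds on the gain and on the curvature term -/

section Gain

variable {n : ℕ}

lemma one_le_div_sub_log {q A : ℝ} (hq : 0 < q) (hA : q ^ 2 ≤ A) : 1 ≤ A / q - Real.log q := by
  have h : q ≤ A / q := by rw [le_div_iff₀ hq]; nlinarith
  linarith [one_le_sub_log hq]

/-- From `q ≤ √A` follow `A / q ≥ √A` and `log q ≤ log √A ≤ √A / 2`, hence `√A ≤ 2 κ`. -/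
lemma exp_neg_le_and_le_of_div_sub_log_le {q A κ : ℝ} (hq : 0 < q) (hA : q ^ 2 ≤ A)
    (h : A / q - Real.log q ≤ κ) : Real.exp (-κ) ≤ q ∧ A ≤ 4 * κ ^ 2 := by
  have hA0 : 0 < A := lt_of_lt_of_le (by positivity) hA
  constructor
  · rw [← Real.le_log_iff_exp_le hq]
    have : 0 < A / q := by positivity
    linarith
  · have hqa : q ≤ √A := Real.le_sqrt_of_sq_le hA
    have ha : 0 < √A := Real.sqrt_pos.2 hA0
    have h1 : √A ≤ A / q := by
      rw [le_div_iff₀ hq]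
      nlinarith [Real.mul_self_sqrt hA0.le]
    have h2 : Real.log q ≤ √A / 2 := by
      have h3 : Real.log q ≤ Real.log (√A) := Real.log_le_log hq hqa
      have h4 := Real.log_le_sub_one_of_pos (half_pos ha)
      rw [Real.log_div ha.ne' two_ne_zero] at h4
      have h5 := Real.log_two_lt_d9
      linarith
    have h3 : √A ≤ 2 * κ := by linarith
    nlinarith [Real.mul_self_sqrt hA0.le]

/-- The estimate `log √q ≤ √q - 1` gives `(√q - 1)² ≤ δ ≤ 1`, so `q ≤ 4` and `(q - 1)² ≤ 9 δ`. With
`A ≤ δ q + q²` the left side is at most `δ q + (q - 1)²`, whence `13 = 4 + 9`. -/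
lemma sub_two_mul_add_one_le {q A : ℝ} (hq : 0 < q) (hA : q ^ 2 ≤ A)
    (h : A / q - Real.log q ≤ 2) : A - 2 * q + 1 ≤ 13 * (A / q - Real.log q - 1) := by
  set δ := A / q - Real.log q - 1 with hδ
  have hw : 0 < √q := Real.sqrt_pos.2 hq
  have hwq : √q * √q = q := Real.mul_self_sqrt hq.le
  have h1 : q ≤ A / q := by rw [le_div_iff₀ hq]; nlinarith
  have h2 : Real.log q ≤ 2 * (√q - 1) := by
    have := Real.log_le_sub_one_of_pos hw
    rw [Real.log_sqrt hq.le] at this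
    linarith
  have h3 : (√q - 1) ^ 2 ≤ δ := by nlinarith
  have h4 : A ≤ (δ + q) * q := by
    have h5 : A / q ≤ δ + q := by linarith [Real.log_le_sub_one_of_pos hq]
    rwa [div_le_iff₀ hq] at h5
  have h6 : √q ≤ 2 := by nlinarith
  have h7 : (q - 1) ^ 2 ≤ 9 * δ := by
    have : (q - 1) ^ 2 = (√q - 1) ^ 2 * (√q + 1) ^ 2 := by
      have h8 : q - 1 = (√q - 1) * (√q + 1) := by linear_combination -hwq
      rw [h8, mul_pow]
    rw [this]
    have h8 : (√q + 1) ^ 2 ≤ 9 := by nlinarith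
    nlinarith [sq_nonneg (√q - 1)]
  have h9 : q ≤ 4 := by nlinarith
  have h10 : 0 ≤ δ := (sq_nonneg _).trans h3
  nlinarith

variable {G B : Matrix (Fin n) (Fin n) ℝ} {s : Vec n}

/-- Normalising by `sᵀ G s` reduces the gain to two scalars. Here `q ^ 2 ≤ A` is Cauchy–Schwarz in
`G⁻¹` for `B s` and `G s`, and `A - 2 q + 1` is the normalised squared residual. -/
lemma bfgsGain_eq (hG : G.PosDef) (hB : B.PosDef) (hs : s ≠ 0) :
    ∃ q A : ℝ, 0 < q ∧ q ^ 2 ≤ A ∧ bfgsGain G B s = A / q - Real.log q ∧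
      s.ofLp ⬝ᵥ (B *ᵥ s.ofLp) = q * (s.ofLp ⬝ᵥ (G *ᵥ s.ofLp)) ∧
      (B *ᵥ s.ofLp) ⬝ᵥ (G⁻¹ *ᵥ (B *ᵥ s.ofLp)) = A * (s.ofLp ⬝ᵥ (G *ᵥ s.ofLp)) ∧
      (B *ᵥ s.ofLp - G *ᵥ s.ofLp) ⬝ᵥ (G⁻¹ *ᵥ (B *ᵥ s.ofLp - G *ᵥ s.ofLp)) =
        (A - 2 * q + 1) * (s.ofLp ⬝ᵥ (G *ᵥ s.ofLp)) := by
  have hs' : s.ofLp ≠ 0 := fun h => hs (by ext i; simp [h])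
  have hq := posDef_dotProduct_pos hB hs'
  have hτ := posDef_dotProduct_pos hG hs'
  have hGG : G⁻¹ *ᵥ (G *ᵥ s.ofLp) = s.ofLp := by
    rw [mulVec_mulVec, nonsing_inv_mul _ hG.det_pos.ne'.isUnit, one_mulVec]
  have hcs := dotProduct_mulVec_sq_le hG.inv.posSemidef (B *ᵥ s.ofLp) (G *ᵥ s.ofLp)
  have hus : (B *ᵥ s.ofLp) ⬝ᵥ (G⁻¹ *ᵥ (G *ᵥ s.ofLp)) = s.ofLp ⬝ᵥ (B *ᵥ s.ofLp) := by
    rw [hGG, dotProduct_comm]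
  have hsu : (G *ᵥ s.ofLp) ⬝ᵥ (G⁻¹ *ᵥ (B *ᵥ s.ofLp)) = s.ofLp ⬝ᵥ (B *ᵥ s.ofLp) := by
    rw [dotProduct_mulVec_comm hG.inv.isHermitian, hus]
  have hss : (G *ᵥ s.ofLp) ⬝ᵥ (G⁻¹ *ᵥ (G *ᵥ s.ofLp)) = s.ofLp ⬝ᵥ (G *ᵥ s.ofLp) := by
    rw [hGG, dotProduct_comm]
  rw [hus, hss] at hcs
  set p := s.ofLp ⬝ᵥ (B *ᵥ s.ofLp)
  set τ := s.ofLp ⬝ᵥ (G *ᵥ s.ofLp)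
  set a := (B *ᵥ s.ofLp) ⬝ᵥ (G⁻¹ *ᵥ (B *ᵥ s.ofLp)) with ha
  refine ⟨p / τ, a / τ, div_pos hq hτ, ?_, ?_, by field_simp, by field_simp, ?_⟩
  · rw [div_pow, div_le_div_iff₀ (by positivity) hτ]
    nlinarith
  · rw [bfgsGain, ← ha, div_div_div_cancel_right₀ hτ.ne']
  · rw [mulVec_sub, dotProduct_sub, sub_dotProduct, sub_dotProduct, hus, hsu, hss, ← ha]
    field_simp
    ring

lemma one_le_bfgsGain (hG : G.PosDef) (hB : B.PosDef) (hs : s ≠ 0) : 1 ≤ bfgsGain G B s := by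
  obtain ⟨q, A, hq, hA, hg, -⟩ := bfgsGain_eq hG hB hs
  exact hg ▸ one_le_div_sub_log hq hA

lemma dotProduct_self_nonneg_real (z : Fin n → ℝ) : 0 ≤ z ⬝ᵥ z := by
  simpa using dotProduct_star_self_nonneg z

lemma exists_bounds_of_bfgsGain_le (hG : G.PosDef) (κ : ℝ) :
    ∃ c > 0, ∃ C > 0, ∀ (B : Matrix (Fin n) (Fin n) ℝ) (s : Vec n), B.PosDef → s ≠ 0 →
      bfgsGain G B s ≤ κ → c * (s.ofLp ⬝ᵥ s.ofLp) ≤ s.ofLp ⬝ᵥ (B *ᵥ s.ofLp) ∧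
        (B *ᵥ s.ofLp) ⬝ᵥ (B *ᵥ s.ofLp) ≤ C * (s.ofLp ⬝ᵥ s.ofLp) := by
  obtain ⟨c₁, hc₁, h₁⟩ := exists_pos_mul_le_dotProduct hG
  obtain ⟨C₁, hC₁, h₂⟩ := exists_dotProduct_le_mul G
  obtain ⟨c₂, hc₂, h₃⟩ := exists_pos_mul_le_dotProduct hG.inv
  refine ⟨Real.exp (-κ) * c₁, by positivity, (4 * κ ^ 2 + 1) * C₁ / c₂, by positivity,
    fun B s hB hs hg => ?_⟩
  obtain ⟨q, A, hq, hA, hgq, hp, ha, -⟩ := bfgsGain_eq hG hB hs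
  obtain ⟨hq1, hA1⟩ := exp_neg_le_and_le_of_div_sub_log_le hq hA (hgq ▸ hg)
  have hss := dotProduct_self_nonneg_real s.ofLp
  have hτ := h₁ s.ofLp
  have hτ0 : 0 ≤ s.ofLp ⬝ᵥ (G *ᵥ s.ofLp) := (by positivity : (0:ℝ) ≤ _).trans hτ
  constructor
  · rw [hp, mul_assoc]; gcongr
  · rw [div_mul_eq_mul_div, le_div_iff₀ hc₂, mul_comm]
    refine (h₃ _).trans ?_
    rw [ha, mul_assoc]
    gcongr
    · linarith
    · exact h₂ _

/-- This is the source of the Dennis–Moré condition. -/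
lemma exists_residual_le_of_bfgsGain_le (hG : G.PosDef) :
    ∃ C > 0, ∀ (B : Matrix (Fin n) (Fin n) ℝ) (s : Vec n), B.PosDef → s ≠ 0 →
      bfgsGain G B s ≤ 2 →
        (B *ᵥ s.ofLp - G *ᵥ s.ofLp) ⬝ᵥ (B *ᵥ s.ofLp - G *ᵥ s.ofLp) ≤
          C * (bfgsGain G B s - 1) * (s.ofLp ⬝ᵥ s.ofLp) := by
  obtain ⟨C₁, hC₁, h₂⟩ := exists_dotProduct_le_mul G
  obtain ⟨c₂, hc₂, h₃⟩ := exists_pos_mul_le_dotProduct hG.inv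
  refine ⟨13 * C₁ / c₂, by positivity, fun B s hB hs hg => ?_⟩
  have hg1 := one_le_bfgsGain hG hB hs
  obtain ⟨q, A, hq, hA, hgq, hp, -, ha⟩ := bfgsGain_eq hG hB hs
  have hA1 := sub_two_mul_add_one_le hq hA (hgq ▸ hg)
  rw [← hgq] at hA1
  have h4 := h₃ (B *ᵥ s.ofLp - G *ᵥ s.ofLp)
  have hτ0 := posSemidef_dotProduct_nonneg hG.posSemidef s.ofLp
  rw [ha] at h4
  have h5 : (A - 2 * q + 1) * (s.ofLp ⬝ᵥ (G *ᵥ s.ofLp)) ≤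
      13 * (bfgsGain G B s - 1) * (C₁ * (s.ofLp ⬝ᵥ s.ofLp)) :=
    mul_le_mul hA1 (h₂ _) hτ0 (by linarith)
  have h6 := h4.trans h5
  rw [show 13 * C₁ / c₂ * (bfgsGain G B s - 1) * (s.ofLp ⬝ᵥ s.ofLp) =
    13 * (bfgsGain G B s - 1) * (C₁ * (s.ofLp ⬝ᵥ s.ofLp)) / c₂ by ring, le_div_iff₀ hc₂]
  linarith

/-- The first-order effect of the perturbation `γ - G s` cancels between the quotient and the
logarithm, so the error is quadratic in `ε`. -/
lemma exists_curvature_error_le (hG : G.PosDef) :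
    ∃ C > 0, ∃ ε₀ > 0, ∀ (s γ : Vec n) (ε : ℝ), s ≠ 0 → 0 ≤ ε → ε ≤ ε₀ →
      (γ.ofLp - G *ᵥ s.ofLp) ⬝ᵥ (γ.ofLp - G *ᵥ s.ofLp) ≤ ε ^ 2 * (s.ofLp ⬝ᵥ s.ofLp) →
      0 < γ.ofLp ⬝ᵥ s.ofLp ∧
      (γ.ofLp ⬝ᵥ (G⁻¹ *ᵥ γ.ofLp)) / (γ.ofLp ⬝ᵥ s.ofLp)
        - Real.log (γ.ofLp ⬝ᵥ s.ofLp / s.ofLp ⬝ᵥ (G *ᵥ s.ofLp)) ≤ 1 + C * ε ^ 2 := by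
  obtain ⟨c, hc, hcb⟩ := exists_pos_mul_le_dotProduct hG
  obtain ⟨C, hC, hCb⟩ := exists_dotProduct_le_mul G⁻¹
  refine ⟨2 * C / c, by positivity, c / 2, by positivity, fun s γ ε hs hε hε₀ hδ => ?_⟩
  have hs' : s.ofLp ≠ 0 := fun h => hs (by ext i; simp [h])
  have hτ := posDef_dotProduct_pos hG hs'
  have hGG : G⁻¹ *ᵥ (G *ᵥ s.ofLp) = s.ofLp := by
    rw [mulVec_mulVec, nonsing_inv_mul _ hG.det_pos.ne'.isUnit, one_mulVec]
  obtain ⟨δ, hδdef⟩ : ∃ δ, δ = γ.ofLp - G *ᵥ s.ofLp := ⟨_, rfl⟩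
  rw [← hδdef] at hδ
  have hγ : γ.ofLp = G *ᵥ s.ofLp + δ := by rw [hδdef]; abel
  have hc1 := hcb s.ofLp
  have hδC := hCb δ
  have hss := dotProduct_self_nonneg_real s.ofLp
  have hcs : (δ ⬝ᵥ s.ofLp) ^ 2 ≤ (δ ⬝ᵥ δ) * (s.ofLp ⬝ᵥ s.ofLp) := by
    simpa using dotProduct_mulVec_sq_le (PosSemidef.one (n := Fin n) (R := ℝ)) δ s.ofLp
  have e1 : γ.ofLp ⬝ᵥ s.ofLp = s.ofLp ⬝ᵥ (G *ᵥ s.ofLp) + δ ⬝ᵥ s.ofLp := by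
    rw [hγ, add_dotProduct, dotProduct_comm (G *ᵥ s.ofLp)]
  have e2 : γ.ofLp ⬝ᵥ (G⁻¹ *ᵥ γ.ofLp) =
      s.ofLp ⬝ᵥ (G *ᵥ s.ofLp) + 2 * (δ ⬝ᵥ s.ofLp) + δ ⬝ᵥ (G⁻¹ *ᵥ δ) := by
    rw [hγ, mulVec_add, add_dotProduct, dotProduct_add, dotProduct_add, hGG,
      dotProduct_mulVec_comm hG.inv.isHermitian (G *ᵥ s.ofLp) δ, hGG,
      dotProduct_comm (G *ᵥ s.ofLp)]
    ring
  rw [e1, e2]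
  set τ := s.ofLp ⬝ᵥ (G *ᵥ s.ofLp)
  set p := δ ⬝ᵥ s.ofLp
  set r := δ ⬝ᵥ (G⁻¹ *ᵥ δ)
  set S := s.ofLp ⬝ᵥ s.ofLp
  have hp : |p| ≤ τ / 2 := by
    have h1 : |p| ≤ ε * S := abs_le_of_sq_le_sq (by nlinarith) (by positivity)
    nlinarith
  have hpl := (abs_le.1 hp).1
  have hpos : 0 < τ + p := by linarith
  refine ⟨hpos, ?_⟩
  -- `log t ≥ 1 - 1 / t` with `t = (τ + p) / τ` removes the first-order term exactly, leaving `1 + r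
  -- / (τ + p)`.
  have hlog := Real.one_sub_inv_le_log_of_pos (div_pos hpos hτ)
  rw [inv_div] at hlog
  have hr : r ≤ C * (ε ^ 2 * S) := hδC.trans (by gcongr)
  have h2 : (τ + 2 * p + r) / (τ + p) = 2 - τ / (τ + p) + r / (τ + p) := by
    field_simp; ring
  have h3 : r / (τ + p) ≤ 2 * C / c * ε ^ 2 := by
    rw [div_le_iff₀ hpos, show 2 * C / c * ε ^ 2 * (τ + p) = 2 * C * ε ^ 2 * ((τ + p) / c) by ring]
    have : S / 2 ≤ (τ + p) / c := by rw [le_div_iff₀ hc]; linarith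
    calc r ≤ 2 * C * ε ^ 2 * (S / 2) := by linarith
      _ ≤ _ := by gcongr
  linarith

end Gain

/-! ### Second order expansions with the Hessian frozen at the limit -/

section LocalExpansion

variable {n m : ℕ} {F : Vec n → Vec m}

lemma contDiff_component (hF : ContDiff ℝ 2 F) (j : Fin m) : ContDiff ℝ 2 fun y => F y j :=
  contDiff_euclidean.1 hF j

lemma inner_grad (j : Fin m) (x v : Vec n) :
    inner ℝ (grad F j x) v = fderiv ℝ (fun y => F y j) x v := by
  rw [grad, gradient, InnerProductSpace.toDual_symm_apply]

lemma fderiv_apply_component (hF : ContDiff ℝ 2 F) (j : Fin m) (x v : Vec n) :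
    (fderiv ℝ F x v) j = inner ℝ (grad F j x) v := by
  rw [inner_grad]
  have h := (EuclideanSpace.proj (𝕜 := ℝ) j).hasFDerivAt.comp x
    (hF.differentiable (by norm_num) x).hasFDerivAt
  exact (congrArg (fun T => T v) h.fderiv).symm

lemma contDiff_grad (hF : ContDiff ℝ 2 F) (j : Fin m) : ContDiff ℝ 1 (grad F j) := by
  have h : ContDiff ℝ 1 (fderiv ℝ fun y => F y j) :=
    (contDiff_component hF j).fderiv_right (by norm_num)
  exact (InnerProductSpace.toDual ℝ (Vec n)).symm.contDiff.comp h

lemma hasFDerivAt_grad (hF : ContDiff ℝ 2 F) (j : Fin m) (x : Vec n) :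
    HasFDerivAt (grad F j) (hess F j x) x :=
  ((contDiff_grad hF j).differentiable (by norm_num) x).hasFDerivAt

lemma hasStrictFDerivAt_grad (hF : ContDiff ℝ 2 F) (j : Fin m) (x : Vec n) :
    HasStrictFDerivAt (grad F j) (hess F j x) x :=
  (contDiff_grad hF j).contDiffAt.hasStrictFDerivAt (by norm_num)

lemma inner_hess_comm (hF : ContDiff ℝ 2 F) (j : Fin m) (x u v : Vec n) :
    inner ℝ (hess F j x u) v = inner ℝ (hess F j x v) u := by
  have h2 : HasFDerivAt (fun y => (InnerProductSpace.toDual ℝ (Vec n)) (grad F j y))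
      ((InnerProductSpace.toDual ℝ (Vec n)).toContinuousLinearEquiv.toContinuousLinearMap.comp
        (hess F j x)) x :=
    (InnerProductSpace.toDual ℝ (Vec n)).toContinuousLinearEquiv.hasFDerivAt.comp x
      (hasFDerivAt_grad hF j x)
  have h1 : ∀ y, HasFDerivAt (fun y => F y j)
      ((InnerProductSpace.toDual ℝ (Vec n)) (grad F j y)) y := fun y =>
    ((contDiff_component hF j).differentiable (by norm_num) y).hasGradientAt
  simpa using second_derivative_symmetric h1 h2 u v

lemma hasDerivAt_component_line (hF : ContDiff ℝ 2 F) (j : Fin m) (x s : Vec n) (t : ℝ) :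
    HasDerivAt (fun t : ℝ => F (x + t • s) j) (inner ℝ (grad F j (x + t • s)) s) t := by
  rw [inner_grad]
  have h := ((contDiff_component hF j).differentiable (by norm_num) (x + t • s)).hasFDerivAt
  have h2 : HasDerivAt (fun t : ℝ => x + t • s) s t := by
    simpa using ((hasDerivAt_id t).smul_const s).const_add x
  exact h.comp_hasDerivAt t h2

/-- Strict differentiability of the gradient at `x'` lets both endpoints move; the bound on values
follows by the mean value inequality along the segment. -/
lemma exists_ball_expansion (hF : ContDiff ℝ 2 F) (x' : Vec n) {ε : ℝ} (hε : 0 < ε) :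
    ∃ r > 0, ∀ x ∈ Metric.ball x' r, ∀ y ∈ Metric.ball x' r, ∀ j,
      ‖grad F j y - grad F j x - hess F j x' (y - x)‖ ≤ ε * ‖y - x‖ ∧
      |F y j - F x j - inner ℝ (grad F j x) (y - x)
        - 1 / 2 * inner ℝ (hess F j x' (y - x)) (y - x)| ≤ ε * ‖y - x‖ ^ 2 := by
  have h1 : ∀ᶠ p : Vec n × Vec n in 𝓝 (x', x'), ∀ j,
      ‖grad F j p.1 - grad F j p.2 - hess F j x' (p.1 - p.2)‖ ≤ ε * ‖p.1 - p.2‖ :=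
    eventually_all.2 fun j => (hasStrictFDerivAt_grad hF j x').isLittleO.def hε
  obtain ⟨r, hr, h⟩ := Metric.eventually_nhds_iff.1 h1
  have hG : ∀ x ∈ Metric.ball x' r, ∀ y ∈ Metric.ball x' r, ∀ j,
      ‖grad F j y - grad F j x - hess F j x' (y - x)‖ ≤ ε * ‖y - x‖ := fun x hx y hy j =>
    h (y := (y, x)) (by rw [Prod.dist_eq]; exact max_lt hy hx) j
  refine ⟨r, hr, fun x hx y hy j => ⟨hG x hx y hy j, ?_⟩⟩
  set s := y - x with hs
  -- Subtracting the quadratic model leaves a function whose derivative is the gradient error paired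
  -- with `s`.
  let φ : ℝ → ℝ := fun t => F (x + t • s) j - t * inner ℝ (grad F j x) s
    - t ^ 2 * (1 / 2 * inner ℝ (hess F j x' s) s)
  have hφ : ∀ t, HasDerivAt φ (inner ℝ (grad F j (x + t • s)) s - inner ℝ (grad F j x) s
      - 2 * t * (1 / 2 * inner ℝ (hess F j x' s) s)) t := fun t => by
    have h := ((hasDerivAt_component_line hF j x s t).sub
      ((hasDerivAt_id t).mul_const (inner ℝ (grad F j x) s))).sub
      ((hasDerivAt_pow 2 t).mul_const (1 / 2 * inner ℝ (hess F j x' s) s))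
    exact HasDerivAt.congr_deriv (f := φ) h (by simp)
  have hb : ∀ t ∈ Set.Ico (0:ℝ) 1, ‖inner ℝ (grad F j (x + t • s)) s - inner ℝ (grad F j x) s
      - 2 * t * (1 / 2 * inner ℝ (hess F j x' s) s)‖ ≤ ε * ‖s‖ ^ 2 := fun t ht => by
    have hmem : x + t • s ∈ Metric.ball x' r :=
      (convex_ball x' r).add_smul_sub_mem hx hy ⟨ht.1, ht.2.le⟩
    have h2 := hG x hx _ hmem j
    rw [add_sub_cancel_left, norm_smul, Real.norm_of_nonneg ht.1, map_smul] at h2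
    have h3 : inner ℝ (grad F j (x + t • s)) s - inner ℝ (grad F j x) s
      - 2 * t * (1 / 2 * inner ℝ (hess F j x' s) s) =
      inner ℝ (grad F j (x + t • s) - grad F j x - t • hess F j x' s) s := by
      rw [inner_sub_left, inner_sub_left, real_inner_smul_left]; ring
    rw [h3]
    refine (norm_inner_le_norm _ _).trans ?_
    have h4 : ε * (t * ‖s‖) ≤ ε * ‖s‖ := by
      have := norm_nonneg s
      gcongr
      nlinarith [ht.2]
    nlinarith [norm_nonneg s]
  have := norm_image_sub_le_of_norm_deriv_le_segment_01' (fun t _ => (hφ t).hasDerivWithinAt) hb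
  simp only [φ, one_smul, zero_smul, add_zero, one_mul, one_pow, Real.norm_eq_abs, zero_mul] at this
  rw [hs, add_sub_cancel, ← hs] at this
  convert this using 2
  ring

lemma exists_ball_holder (hF : ContDiff ℝ 2 F) {x' : Vec n} {ν M : ℝ} (hν : 0 < ν) (hM : 0 < M)
    (h : ∀ᶠ y in 𝓝 x', ∀ j, ‖hess F j y - hess F j x'‖ ≤ M * ‖y - x'‖ ^ ν) :
    ∃ r > 0, ∀ R < r, ∀ x ∈ Metric.closedBall x' R, ∀ y ∈ Metric.closedBall x' R, ∀ j,
      ‖grad F j y - grad F j x - hess F j x' (y - x)‖ ≤ M * R ^ ν * ‖y - x‖ := by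
  obtain ⟨r, hr, h⟩ := Metric.eventually_nhds_iff.1 h
  refine ⟨r, hr, fun R hR x hx y hy j => ?_⟩
  refine (convex_closedBall x' R).norm_image_sub_le_of_norm_hasFDerivWithin_le'
    (fun z _ => (hasFDerivAt_grad hF j z).hasFDerivWithinAt) (fun z hz => ?_) hx hy
  have hz' : dist z x' ≤ R := hz
  refine (h (hz'.trans_lt hR) j).trans ?_
  rw [← dist_eq_norm]
  gcongr

/-- The matrix of the Hessian of `F_j`. -/
def hessMatrix (F : Vec n → Vec m) (j : Fin m) (x : Vec n) : Matrix (Fin n) (Fin n) ℝ :=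
  (Matrix.toEuclideanCLM (n := Fin n) (𝕜 := ℝ)).symm (hess F j x)

lemma hessMatrix_mulVec (j : Fin m) (x v : Vec n) :
    hessMatrix F j x *ᵥ v.ofLp = (hess F j x v).ofLp := by
  have h := Matrix.toEuclideanCLM_toLp (hessMatrix F j x) v.ofLp
  rw [hessMatrix, StarAlgEquiv.apply_symm_apply] at h
  exact (congrArg WithLp.ofLp h).symm

lemma inner_eq_dotProduct (u v : Vec n) : inner ℝ u v = u.ofLp ⬝ᵥ v.ofLp :=
  (dotProduct_eq_inner u.ofLp v.ofLp).symm

lemma hessMatrix_posDef (hF : ContDiff ℝ 2 F) {j : Fin m} {x : Vec n}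
    (hpos : ∀ z : Vec n, z ≠ 0 → 0 < inner ℝ z (hess F j x z)) : (hessMatrix F j x).PosDef := by
  refine PosDef.of_dotProduct_mulVec_pos ?_ fun z hz => ?_
  · have hsymm : (Matrix.toEuclideanLin (hessMatrix F j x)).IsSymmetric := fun u v => by
      have h : ∀ w, Matrix.toEuclideanLin (hessMatrix F j x) w = hess F j x w := fun w => by
        ext i
        simpa using congrFun (hessMatrix_mulVec (F := F) j x w) i
      rw [h, h, inner_hess_comm hF, real_inner_comm]
    exact Matrix.isSymmetric_toEuclideanLin_iff.1 hsymm
  · have h := hpos (WithLp.toLp 2 z) (fun h => hz (by simpa using congrArg WithLp.ofLp h))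
    rw [inner_eq_dotProduct, ← hessMatrix_mulVec] at h
    simpa using h

end LocalExpansion

/-! ### Multipliers and descent for the direction subproblem -/

section Subproblem

/-- Gordan's alternative for a finite family of vectors. -/
lemma exists_stdSimplex_sum_eq_zero_or {E : Type*} [NormedAddCommGroup E] [NormedSpace ℝ E]
    {m : ℕ} (p : Fin m → E) :
    (∃ w ∈ stdSimplex ℝ (Fin m), ∑ j, w j • p j = 0) ∨
      ∃ f : E →L[ℝ] ℝ, ∃ u < 0, ∀ j, f (p j) < u := by
  let T : (Fin m → ℝ) →ₗ[ℝ] E := Fintype.linearCombination ℝ p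
  have hT : ∀ w, T w = ∑ j, w j • p j := fun w => Fintype.linearCombination_apply ℝ p w
  by_cases h : (0 : E) ∈ T '' stdSimplex ℝ (Fin m)
  · obtain ⟨w, hw, h0⟩ := h
    exact Or.inl ⟨w, hw, (hT w).symm.trans h0⟩
  · right
    have hcont : Continuous T := by
      rw [show (T : (Fin m → ℝ) → E) = fun w => ∑ j, w j • p j from funext hT]
      fun_prop
    obtain ⟨f, u, hf, hu⟩ := geometric_hahn_banach_closed_point
      ((convex_stdSimplex ℝ (Fin m)).linear_image T)
      ((isCompact_stdSimplex ℝ (Fin m)).image hcont).isClosed h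
    refine ⟨f, u, by simpa using hu, fun j => hf _ ⟨Pi.single j 1, single_mem_stdSimplex ℝ j, ?_⟩⟩
    rw [hT, Finset.sum_eq_single j (fun i _ hi => by simp [hi]) (by simp)]
    simp

variable {n m : ℕ} {F : Vec n → Vec m} {B : Fin m → Matrix (Fin n) (Fin n) ℝ} {x d : Vec n}

/-- The `j`-th quadratic piece of the direction subproblem. -/
def qnPiece (F : Vec n → Vec m) (B : Fin m → Matrix (Fin n) (Fin n) ℝ) (x : Vec n) (j : Fin m)
    (d : Vec n) : ℝ :=
  inner ℝ (grad F j x) d + 1 / 2 * (d.ofLp ⬝ᵥ (B j *ᵥ d.ofLp))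

lemma qnPiece_le_qnModel (j : Fin m) : qnPiece F B x j d ≤ qnModel F B x d :=
  le_ciSup (f := fun j => qnPiece F B x j d) (Set.finite_range _).bddAbove j

lemma inner_le_maxDirDeriv (j : Fin m) : inner ℝ (grad F j x) d ≤ maxDirDeriv F x d :=
  le_ciSup (f := fun j => inner ℝ (grad F j x) d) (Set.finite_range _).bddAbove j

lemma exists_inner_eq_maxDirDeriv (hm : 0 < m) (F : Vec n → Vec m) (x d : Vec n) :
    ∃ j, inner ℝ (grad F j x) d = maxDirDeriv F x d :=
  have : Nonempty (Fin m) := ⟨⟨0, hm⟩⟩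
  exists_eq_ciSup_of_finite

lemma exists_qnPiece_eq_qnModel (hm : 0 < m) (F : Vec n → Vec m)
    (B : Fin m → Matrix (Fin n) (Fin n) ℝ) (x d : Vec n) :
    ∃ j, qnPiece F B x j d = qnModel F B x d :=
  have : Nonempty (Fin m) := ⟨⟨0, hm⟩⟩
  exists_eq_ciSup_of_finite (f := fun j => qnPiece F B x j d)

lemma qnPiece_add_smul (hB : ∀ j, (B j).IsHermitian) (j : Fin m) (v : Vec n) (t : ℝ) :
    qnPiece F B x j (d + t • v) = qnPiece F B x j d
      + t * inner ℝ (grad F j x + WithLp.toLp 2 (B j *ᵥ d.ofLp)) v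
      + t ^ 2 * (1 / 2 * (v.ofLp ⬝ᵥ (B j *ᵥ v.ofLp))) := by
  have h1 : inner ℝ (WithLp.toLp 2 (B j *ᵥ d.ofLp) : Vec n) v = d.ofLp ⬝ᵥ (B j *ᵥ v.ofLp) := by
    rw [inner_eq_dotProduct, dotProduct_comm, dotProduct_mulVec_comm (hB j)]
  have h2 := dotProduct_mulVec_comm (hB j) v.ofLp d.ofLp
  simp only [qnPiece, inner_add_right, inner_add_left, real_inner_smul_right, h1, WithLp.ofLp_add,
    WithLp.ofLp_smul, mulVec_add, mulVec_smul, dotProduct_add, add_dotProduct, dotProduct_smul,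
    smul_dotProduct, smul_eq_mul, h2]
  ring

/-- Gordan's alternative is applied to the pairs (gradient of a piece, slack of the piece). A zero
convex combination encodes stationarity and complementarity together; a separating functional gives
a direction lowering the model below its minimum. -/
lemma exists_multiplier (hm : 0 < m) (hB : ∀ j, (B j).IsHermitian)
    (hmin : IsMinOn (qnModel F B x) Set.univ d) :
    ∃ w ∈ stdSimplex ℝ (Fin m),
      ∑ j, w j • (grad F j x + WithLp.toLp 2 (B j *ᵥ d.ofLp)) = 0 ∧
      ∑ j, w j * qnPiece F B x j d = qnModel F B x d := by
  set θ := qnModel F B x d with hθ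
  rcases exists_stdSimplex_sum_eq_zero_or (fun j : Fin m =>
    ((grad F j x + WithLp.toLp 2 (B j *ᵥ d.ofLp), θ - qnPiece F B x j d) : Vec n × ℝ))
    with ⟨w, hw, h0⟩ | ⟨f, u, hu, hf⟩
  · refine ⟨w, hw, ?_, ?_⟩
    · simpa [Prod.fst_sum, -smul_add] using congrArg Prod.fst h0
    · have h := congrArg Prod.snd h0
      simp only [Prod.snd_sum, Prod.smul_snd, smul_eq_mul, mul_sub, Finset.sum_sub_distrib,
        ← Finset.sum_mul, hw.2, one_mul, Prod.snd_zero] at h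
      linarith
  · exfalso
    let v := (InnerProductSpace.toDual ℝ (Vec n)).symm (f.comp (ContinuousLinearMap.inl ℝ _ ℝ))
    have hv : ∀ g : Vec n, ∀ τ : ℝ, f (g, τ) = inner ℝ g v + τ * f (0, 1) := fun g τ => by
      have h1 : f (g, 0) = inner ℝ g v := by
        rw [real_inner_comm]
        have h := InnerProductSpace.toDual_symm_apply (x := g)
          (y := f.comp (ContinuousLinearMap.inl ℝ (Vec n) ℝ))
        exact h.symm
      have h2 : ((g, τ) : Vec n × ℝ) = (g, 0) + τ • (0, 1) := by simp
      rw [h2, map_add, map_smul, h1, smul_eq_mul]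
    set a := f (0, 1)
    set K := ∑ j, |1 / 2 * (v.ofLp ⬝ᵥ (B j *ᵥ v.ofLp))|
    have hK : ∀ j, 1 / 2 * (v.ofLp ⬝ᵥ (B j *ᵥ v.ofLp)) ≤ K := fun j =>
      (le_abs_self _).trans (Finset.single_le_sum
        (f := fun j => |1 / 2 * (v.ofLp ⬝ᵥ (B j *ᵥ v.ofLp))|) (fun _ _ => abs_nonneg _)
        (Finset.mem_univ j))
    -- For such `t` the inequalities combine to `(1 + t a) · slack ≤ t (u + t K) < 0`, against a
    -- nonnegative slack.
    have e1 : ∀ᶠ t : ℝ in 𝓝 0, 0 < 1 + t * a :=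
      ((by fun_prop : Continuous fun t : ℝ => 1 + t * a).tendsto' 0 1 (by simp)).eventually
        (lt_mem_nhds zero_lt_one)
    have e2 : ∀ᶠ t : ℝ in 𝓝 0, u + t * K < 0 :=
      ((by fun_prop : Continuous fun t : ℝ => u + t * K).tendsto' 0 u (by simp)).eventually
        (gt_mem_nhds hu)
    obtain ⟨t, ⟨h1, h2⟩, ht⟩ := (((e1.and e2).filter_mono nhdsWithin_le_nhds).and
      (self_mem_nhdsWithin : Set.Ioi (0:ℝ) ∈ 𝓝[>] 0)).exists
    have ht0 : 0 < t := ht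
    obtain ⟨j, hj⟩ := exists_qnPiece_eq_qnModel hm F B x (d + t • v)
    have h3 : θ ≤ qnModel F B x (d + t • v) := hmin (Set.mem_univ _)
    rw [← hj, qnPiece_add_smul hB] at h3
    have h4 := hf j
    rw [hv] at h4
    have h5 := qnPiece_le_qnModel (F := F) (B := B) (x := x) (d := d) j
    rw [← hθ] at h5
    have h6 : t * (u + t * K) < 0 := mul_neg_of_pos_of_neg ht0 h2
    have h7 : t ^ 2 * (1 / 2 * (v.ofLp ⬝ᵥ (B j *ᵥ v.ofLp))) ≤ t ^ 2 * K :=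
      mul_le_mul_of_nonneg_left (hK j) (sq_nonneg t)
    have h8 : 0 ≤ (1 + t * a) * (θ - qnPiece F B x j d) := mul_nonneg h1.le (by linarith)
    have h9 := mul_lt_mul_of_pos_left h4 ht0
    nlinarith

lemma sum_smul_grad_ne_zero (hF : ContDiff ℝ 2 F) (hx : ¬ ParetoCritical F x) {w : Fin m → ℝ}
    (hw : w ∈ stdSimplex ℝ (Fin m)) : ∑ j, w j • grad F j x ≠ 0 := by
  intro h0
  obtain ⟨-, hv, v, rfl⟩ := Set.nonempty_iff_ne_empty.2 hx
  have hv' : ∀ j, inner ℝ (grad F j x) v < 0 := fun j => by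
    rw [← fderiv_apply_component hF]; exact hv j
  have h1 : ∑ j, w j * inner ℝ (grad F j x) v = 0 := by
    have := congrArg (fun g => inner ℝ g v) h0
    simpa [sum_inner, real_inner_smul_left] using this
  have h2 := (Finset.sum_eq_zero_iff_of_nonpos fun j _ =>
    mul_nonpos_of_nonneg_of_nonpos (hw.1 j) (hv' j).le).1 h1
  have h3 : ∀ j, w j = 0 := fun j =>
    (mul_eq_zero.1 (h2 j (Finset.mem_univ j))).resolve_right (hv' j).ne
  have h4 := hw.2
  simp [h3] at h4

lemma direction_ne_zero (hm : 0 < m) (hF : ContDiff ℝ 2 F) (hx : ¬ ParetoCritical F x)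
    (hB : ∀ j, (B j).IsHermitian) (hmin : IsMinOn (qnModel F B x) Set.univ d) : d ≠ 0 := by
  rintro rfl
  obtain ⟨w, hw, h0, -⟩ := exists_multiplier hm hB hmin
  exact sum_smul_grad_ne_zero hF hx hw (by simpa using h0)

lemma two_mul_qnModel_eq {w : Fin m → ℝ}
    (h0 : ∑ j, w j • (grad F j x + WithLp.toLp 2 (B j *ᵥ d.ofLp)) = 0)
    (h1 : ∑ j, w j * qnPiece F B x j d = qnModel F B x d) :
    2 * qnModel F B x d = ∑ j, w j * inner ℝ (grad F j x) d ∧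
      2 * qnModel F B x d = -∑ j, w j * (d.ofLp ⬝ᵥ (B j *ᵥ d.ofLp)) := by
  have h2 : ∑ j, w j * inner ℝ (grad F j x) d + ∑ j, w j * (d.ofLp ⬝ᵥ (B j *ᵥ d.ofLp)) = 0 := by
    have := congrArg (fun g => inner ℝ g d) h0
    simp only [sum_inner, real_inner_smul_left, inner_add_left, inner_zero_left, mul_add,
      Finset.sum_add_distrib] at this
    rw [← this]
    congr 1
  have h3 : qnModel F B x d = ∑ j, w j * inner ℝ (grad F j x) d
      + 1 / 2 * ∑ j, w j * (d.ofLp ⬝ᵥ (B j *ᵥ d.ofLp)) := by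
    rw [← h1, Finset.mul_sum, ← Finset.sum_add_distrib]
    exact Finset.sum_congr rfl fun j _ => by rw [qnPiece]; ring
  constructor <;> linarith

lemma sum_mul_le_of_stdSimplex {w a : Fin m → ℝ} (hw : w ∈ stdSimplex ℝ (Fin m)) {b : ℝ}
    (h : ∀ j, a j ≤ b) : ∑ j, w j * a j ≤ b := by
  calc ∑ j, w j * a j ≤ ∑ j, w j * b :=
        Finset.sum_le_sum fun j _ => mul_le_mul_of_nonneg_left (h j) (hw.1 j)
    _ = b := by rw [← Finset.sum_mul, hw.2, one_mul]

lemma le_sum_mul_of_stdSimplex {w a : Fin m → ℝ} (hw : w ∈ stdSimplex ℝ (Fin m)) {b : ℝ}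
    (h : ∀ j, b ≤ a j) : b ≤ ∑ j, w j * a j := by
  calc b = ∑ j, w j * b := by rw [← Finset.sum_mul, hw.2, one_mul]
    _ ≤ _ := Finset.sum_le_sum fun j _ => mul_le_mul_of_nonneg_left (h j) (hw.1 j)

lemma norm_sum_smul_le_of_stdSimplex {w : Fin m → ℝ} (hw : w ∈ stdSimplex ℝ (Fin m))
    {a : Fin m → Vec n} {b : ℝ} (h : ∀ j, ‖a j‖ ≤ b) : ‖∑ j, w j • a j‖ ≤ b := by
  refine (norm_sum_le _ _).trans ?_
  simp only [norm_smul]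
  calc ∑ j, ‖w j‖ * ‖a j‖ = ∑ j, w j * ‖a j‖ :=
        Finset.sum_congr rfl fun j _ => by rw [Real.norm_of_nonneg (hw.1 j)]
    _ ≤ b := sum_mul_le_of_stdSimplex hw h

lemma two_mul_qnModel_le_maxDirDeriv (hm : 0 < m) (hB : ∀ j, (B j).IsHermitian)
    (hmin : IsMinOn (qnModel F B x) Set.univ d) :
    2 * qnModel F B x d ≤ maxDirDeriv F x d := by
  obtain ⟨w, hw, h0, h1⟩ := exists_multiplier hm hB hmin
  rw [(two_mul_qnModel_eq h0 h1).1]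
  exact sum_mul_le_of_stdSimplex hw fun j => inner_le_maxDirDeriv j

/-- At an index attaining `𝒟`, the piece is at most the model value, itself at most `-b / 2` by
duality; the quadratic part of that piece supplies the other `b / 2`. -/
lemma maxDirDeriv_le_neg (hm : 0 < m) (hB : ∀ j, (B j).IsHermitian)
    (hmin : IsMinOn (qnModel F B x) Set.univ d) {b : ℝ}
    (hb : ∀ j, b ≤ d.ofLp ⬝ᵥ (B j *ᵥ d.ofLp)) : maxDirDeriv F x d ≤ -b := by
  obtain ⟨w, hw, h0, h1⟩ := exists_multiplier hm hB hmin
  obtain ⟨j, hj⟩ := exists_inner_eq_maxDirDeriv hm F x d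
  have h2 := (two_mul_qnModel_eq h0 h1).2
  have h3 := le_sum_mul_of_stdSimplex hw hb
  have h4 := qnPiece_le_qnModel (F := F) (B := B) (x := x) (d := d) j
  rw [qnPiece, hj] at h4
  linarith [hb j]

lemma maxDirDeriv_neg (hm : 0 < m) (hF : ContDiff ℝ 2 F) (hx : ¬ ParetoCritical F x)
    (hB : ∀ j, (B j).PosDef) (hmin : IsMinOn (qnModel F B x) Set.univ d) :
    maxDirDeriv F x d < 0 := by
  have hB' : ∀ j, (B j).IsHermitian := fun j => (hB j).isHermitian
  have hd := direction_ne_zero hm hF hx hB' hmin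
  have hd' : d.ofLp ≠ 0 := fun h => hd (by ext i; simp [h])
  have : Nonempty (Fin m) := ⟨⟨0, hm⟩⟩
  obtain ⟨i, hi⟩ := exists_eq_ciInf_of_finite (f := fun j => d.ofLp ⬝ᵥ (B j *ᵥ d.ofLp))
  have h1 := maxDirDeriv_le_neg hm hB' hmin (b := d.ofLp ⬝ᵥ (B i *ᵥ d.ofLp)) fun j => by
    rw [hi]
    exact ciInf_le (f := fun j => d.ofLp ⬝ᵥ (B j *ᵥ d.ofLp)) (Set.finite_range _).bddBelow j
  linarith [posDef_dotProduct_pos (hB i) hd']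

end Subproblem

/-! ### Basic properties of a run: definiteness, descent, step bounds -/

section Run

variable {n m : ℕ} {F : Vec n → Vec m} {ρ σ ϑlo ϑhi : ℝ} {x d : ℕ → Vec n} {α : ℕ → ℝ}
  {μ : ℕ → Fin m → ℝ} {ϑ : ℕ → ℝ} {B : ℕ → Fin m → Matrix (Fin n) (Fin n) ℝ} {x' : Vec n}

lemma IsRun.step_eq (hrun : IsRun F ρ σ ϑlo ϑhi x d α μ ϑ B) (k : ℕ) :
    x (k + 1) - x k = α k • d k := by
  rw [hrun.next_iterate, add_sub_cancel_left]

lemma corr_nonneg {μ : Fin m → ℝ} {t : ℝ} (ht : 0 ≤ t) (j : Fin m) (y z : Vec n) :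
    0 ≤ corr F μ t j y z := by
  rw [corr]; positivity

/-- The `max` term cancels any negative curvature, so `ϑ ‖∑ μ_i ∇F_i‖ ‖s‖²` remains as a positive
lower bound. -/
lemma gam_dotProduct_pos {μ : Fin m → ℝ} {t : ℝ} {y z : Vec n}
    (ht : 0 < t) (hw : ∑ i, μ i • grad F i y ≠ 0) (hyz : z - y ≠ 0) (j : Fin m) :
    0 < (gam F μ t j y z).ofLp ⬝ᵥ (z - y).ofLp := by
  rw [← inner_eq_dotProduct, gam, inner_add_left, real_inner_smul_left, real_inner_self_eq_norm_sq,
    corr]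
  have h1 : 0 < ‖z - y‖ ^ 2 := by have := norm_pos_iff.2 hyz; positivity
  have h2 : inner ℝ (grad F j z - grad F j y) (z - y) = eta F j y z * ‖z - y‖ ^ 2 := by
    rw [eta]; field_simp
  have h3 : 0 < t * ‖∑ i, μ i • grad F i y‖ := mul_pos ht (norm_pos_iff.2 hw)
  have h4 := le_max_left (-eta F j y z) 0
  rw [h2]
  nlinarith

lemma IsRun.scalar_pos (hrun : IsRun F ρ σ ϑlo ϑhi x d α μ ϑ B) (k : ℕ) : 0 < ϑ k :=
  hrun.lo_pos.trans (hrun.scalar_mem k).1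

/-- Definiteness at index `k` is a hypothesis so that this can serve inside the induction proving it
for all `k`. -/
lemma IsRun.step_ne_zero_of_posDef (hrun : IsRun F ρ σ ϑlo ϑhi x d α μ ϑ B) (hm : 0 < m)
    (hF : ContDiff ℝ 2 F) {k : ℕ} (hB : ∀ j, (B k j).PosDef) : x (k + 1) - x k ≠ 0 := by
  rw [hrun.step_eq]
  exact smul_ne_zero (hrun.step_pos k).ne' (direction_ne_zero hm hF (hrun.not_critical k)
    (fun j => (hB j).isHermitian) (hrun.direction k))

lemma IsRun.posDef (hrun : IsRun F ρ σ ϑlo ϑhi x d α μ ϑ B) (hm : 0 < m)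
    (hF : ContDiff ℝ 2 F) (k : ℕ) : ∀ j, (B k j).PosDef := by
  induction k with
  | zero => exact hrun.init_posDef
  | succ k ih =>
    intro j
    have hs := hrun.step_ne_zero_of_posDef hm hF ih
    rw [hrun.next_matrix]
    exact bfgsUpdate_posDef (ih j) hs (gam_dotProduct_pos (hrun.scalar_pos k)
      (sum_smul_grad_ne_zero hF (hrun.not_critical k) (hrun.multiplier k)) hs j)

lemma IsRun.step_ne_zero (hrun : IsRun F ρ σ ϑlo ϑhi x d α μ ϑ B) (hm : 0 < m)
    (hF : ContDiff ℝ 2 F) (k : ℕ) : x (k + 1) - x k ≠ 0 :=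
  hrun.step_ne_zero_of_posDef hm hF (hrun.posDef hm hF k)

lemma IsRun.isHermitian (hrun : IsRun F ρ σ ϑlo ϑhi x d α μ ϑ B) (hm : 0 < m)
    (hF : ContDiff ℝ 2 F) (k : ℕ) (j : Fin m) : (B k j).IsHermitian :=
  (hrun.posDef hm hF k j).isHermitian

lemma IsRun.dir_ne_zero (hrun : IsRun F ρ σ ϑlo ϑhi x d α μ ϑ B) (hm : 0 < m)
    (hF : ContDiff ℝ 2 F) (k : ℕ) : d k ≠ 0 :=
  direction_ne_zero hm hF (hrun.not_critical k) (hrun.isHermitian hm hF k) (hrun.direction k)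

lemma IsRun.maxDirDeriv_neg (hrun : IsRun F ρ σ ϑlo ϑhi x d α μ ϑ B) (hm : 0 < m)
    (hF : ContDiff ℝ 2 F) (k : ℕ) : maxDirDeriv F (x k) (d k) < 0 :=
  MOBFGS.maxDirDeriv_neg hm hF (hrun.not_critical k) (hrun.posDef hm hF k) (hrun.direction k)

/-- The decrease guaranteed by the sufficient decrease condition at iteration `k`. -/
def decrease (F : Vec n → Vec m) (ρ : ℝ) (x d : ℕ → Vec n) (α : ℕ → ℝ) (k : ℕ) : ℝ :=
  -(ρ * α k * maxDirDeriv F (x k) (d k))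

lemma IsRun.decrease_pos (hrun : IsRun F ρ σ ϑlo ϑhi x d α μ ϑ B) (hm : 0 < m)
    (hF : ContDiff ℝ 2 F) (k : ℕ) : 0 < decrease F ρ x d α k :=
  neg_pos.2 (mul_neg_of_pos_of_neg (mul_pos hrun.rho_pos (hrun.step_pos k))
    (hrun.maxDirDeriv_neg hm hF k))

lemma IsRun.value_succ_le (hrun : IsRun F ρ σ ϑlo ϑhi x d α μ ϑ B) (k : ℕ) (j : Fin m) :
    F (x (k + 1)) j ≤ F (x k) j - decrease F ρ x d α k := by
  have h := (hrun.step_wolfe k).1 j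
  rw [← hrun.next_iterate] at h
  rw [decrease]; linarith

lemma IsRun.value_lt (hrun : IsRun F ρ σ ϑlo ϑhi x d α μ ϑ B) (hm : 0 < m)
    (hF : ContDiff ℝ 2 F) (hconv : Tendsto x atTop (𝓝 x')) (k : ℕ) (j : Fin m) :
    F x' j < F (x k) j := by
  have hanti : StrictAnti fun k => F (x k) j := strictAnti_nat_of_succ_lt fun k => by
    linarith [hrun.value_succ_le k j, hrun.decrease_pos hm hF k]
  have hlim : Tendsto (fun k => F (x k) j) atTop (𝓝 (F x' j)) :=
    ((contDiff_component hF j).continuous.tendsto x').comp hconv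
  exact (hanti.antitone.le_of_tendsto hlim (k + 1)).trans_lt (hanti k.lt_succ_self)

lemma IsRun.ne_limit (hrun : IsRun F ρ σ ϑlo ϑhi x d α μ ϑ B) (hm : 0 < m)
    (hF : ContDiff ℝ 2 F) (hconv : Tendsto x atTop (𝓝 x')) (k : ℕ) : x k ≠ x' := fun h => by
  have := hrun.value_lt hm hF hconv k ⟨0, hm⟩
  rw [h] at this
  exact lt_irrefl _ this

lemma exists_pos_forall_of_antitone {P : Fin m → ℝ → Prop}
    (hP : ∀ j c c', 0 < c' → c' ≤ c → P j c → P j c') (h : ∀ j, ∃ c > 0, P j c) :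
    ∃ c > 0, ∀ j, P j c := by
  have h1 : ∀ᶠ c in 𝓝[>] (0:ℝ), ∀ j, P j c := eventually_all.2 fun j => by
    obtain ⟨c, hc, hPc⟩ := h j
    filter_upwards [Ioc_mem_nhdsGT hc] with c' hc' using hP j c c' hc'.1 hc'.2 hPc
  obtain ⟨c, hc, hc0⟩ := (h1.and self_mem_nhdsWithin).exists
  exact ⟨c, hc0, hc⟩

lemma exists_pos_forall_of_monotone {P : Fin m → ℝ → Prop}
    (hP : ∀ j c c', c ≤ c' → P j c → P j c') (h : ∀ j, ∃ c > 0, P j c) :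
    ∃ c > 0, ∀ j, P j c := by
  have h1 : ∀ᶠ c in atTop, ∀ j, P j c := eventually_all.2 fun j => by
    obtain ⟨c, hc, hPc⟩ := h j
    filter_upwards [eventually_ge_atTop c] with c' hc' using hP j c c' hc' hPc
  obtain ⟨c, hc, hc0⟩ := (h1.and (eventually_gt_atTop 0)).exists
  exact ⟨c, hc0, hc⟩

lemma exists_hess_norm_le (F : Vec n → Vec m) (x' : Vec n) :
    ∃ L > 0, ∀ j, ∀ v : Vec n, ‖hess F j x' v‖ ≤ L * ‖v‖ :=
  exists_pos_forall_of_monotone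
    (P := fun j L => ∀ v : Vec n, ‖hess F j x' v‖ ≤ L * ‖v‖)
    (fun j c c' h hP v => (hP v).trans (by gcongr)) fun j =>
      ⟨‖hess F j x'‖ + 1, by positivity, fun v => ((hess F j x').le_opNorm v).trans
        (by gcongr; linarith)⟩

lemma exists_hess_bounds (hF : ContDiff ℝ 2 F)
    (hpos : ∀ j, ∀ z : Vec n, z ≠ 0 → 0 < inner ℝ z (hess F j x' z)) :
    ∃ c > 0, ∃ L > 0, ∀ j, ∀ v : Vec n, c * ‖v‖ ^ 2 ≤ inner ℝ (hess F j x' v) v ∧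
      ‖hess F j x' v‖ ≤ L * ‖v‖ := by
  obtain ⟨c, hc, h1⟩ := exists_pos_forall_of_antitone
    (P := fun j c => ∀ v : Vec n, c * ‖v‖ ^ 2 ≤ inner ℝ (hess F j x' v) v)
    (fun j c c' _ h hP v => (mul_le_mul_of_nonneg_right h (sq_nonneg _)).trans (hP v)) fun j => by
      obtain ⟨c, hc, h⟩ := exists_pos_mul_le_dotProduct (hessMatrix_posDef hF (hpos j))
      refine ⟨c, hc, fun v => ?_⟩
      have := h v.ofLp
      rwa [hessMatrix_mulVec, ← inner_eq_dotProduct, ← inner_eq_dotProduct,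
        real_inner_self_eq_norm_sq, real_inner_comm] at this
  obtain ⟨L, hL, h2⟩ := exists_hess_norm_le F x'
  exact ⟨c, hc, L, hL, fun j v => ⟨h1 j v, h2 j v⟩⟩

lemma tendsto_step_zero (hconv : Tendsto x atTop (𝓝 x')) :
    Tendsto (fun k => x (k + 1) - x k) atTop (𝓝 0) := by
  simpa using (hconv.comp (tendsto_add_atTop_nat 1)).sub hconv

/-- Near the end of a convergent run, the steps satisfy the second order expansion at the limit. -/
lemma eventually_step_expansion (hF : ContDiff ℝ 2 F) (hconv : Tendsto x atTop (𝓝 x')) {ε : ℝ}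
    (hε : 0 < ε) : ∀ᶠ k in atTop, ∀ j,
      ‖grad F j (x (k + 1)) - grad F j (x k) - hess F j x' (x (k + 1) - x k)‖
        ≤ ε * ‖x (k + 1) - x k‖ ∧
      |F (x (k + 1)) j - F (x k) j - inner ℝ (grad F j (x k)) (x (k + 1) - x k)
        - 1 / 2 * inner ℝ (hess F j x' (x (k + 1) - x k)) (x (k + 1) - x k)|
        ≤ ε * ‖x (k + 1) - x k‖ ^ 2 := by
  obtain ⟨r, hr, h⟩ := exists_ball_expansion hF x' hε
  have h1 := hconv.eventually (Metric.ball_mem_nhds x' hr)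
  have h2 := (hconv.comp (tendsto_add_atTop_nat 1)).eventually (Metric.ball_mem_nhds x' hr)
  filter_upwards [h1, h2] with k hk hk1 j using h _ hk _ hk1 j

/-- No objective increases along the step, so the linear term must outweigh the positive quadratic
one: `c/2` from the Hessian, less `c/4` from the expansion error. -/
lemma IsRun.exists_sq_step_le (hrun : IsRun F ρ σ ϑlo ϑhi x d α μ ϑ B) (hm : 0 < m)
    (hF : ContDiff ℝ 2 F) (hconv : Tendsto x atTop (𝓝 x'))
    (hpos : ∀ j, ∀ z : Vec n, z ≠ 0 → 0 < inner ℝ z (hess F j x' z)) :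
    ∃ C > 0, ∀ᶠ k in atTop, ‖x (k + 1) - x k‖ ^ 2 ≤ C * decrease F ρ x d α k := by
  obtain ⟨c, hc, L, hL, hb⟩ := exists_hess_bounds hF hpos
  refine ⟨4 / (c * ρ), by have := hrun.rho_pos; positivity, ?_⟩
  filter_upwards [eventually_step_expansion hF hconv (show 0 < c / 4 by positivity)] with k hk
  obtain ⟨j, hj⟩ := exists_inner_eq_maxDirDeriv hm F (x k) (d k)
  have h1 := (abs_le.1 (hk j).2).1
  have h2 := (hb j (x (k + 1) - x k)).1
  have h3 := hrun.value_succ_le k j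
  have h4 : inner ℝ (grad F j (x k)) (x (k + 1) - x k) = α k * maxDirDeriv F (x k) (d k) := by
    rw [hrun.step_eq, real_inner_smul_right, hj]
  have hP := hrun.decrease_pos hm hF k
  have h5 : ρ * (α k * maxDirDeriv F (x k) (d k)) = -decrease F ρ x d α k := by
    rw [decrease]; ring
  have h6 : c / 4 * ‖x (k + 1) - x k‖ ^ 2 ≤ -(α k * maxDirDeriv F (x k) (d k)) := by
    rw [h4] at h1; linarith
  rw [div_mul_eq_mul_div, le_div_iff₀ (mul_pos hc hrun.rho_pos)]
  nlinarith [mul_le_mul_of_nonneg_left h6 hrun.rho_pos.le]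

/-- The curvature condition makes `𝒟` rise by at least `-(1 - σ) 𝒟`, while Lipschitz gradients cap
the rise. This is what bounds step sizes below. -/
lemma IsRun.exists_neg_maxDirDeriv_le (hrun : IsRun F ρ σ ϑlo ϑhi x d α μ ϑ B) (hm : 0 < m)
    (hF : ContDiff ℝ 2 F) (hconv : Tendsto x atTop (𝓝 x')) :
    ∃ L > 0, ∀ᶠ k in atTop, -maxDirDeriv F (x k) (d k) ≤ L * (α k * ‖d k‖ ^ 2) := by
  obtain ⟨L, hL, hLb⟩ := exists_hess_norm_le F x'
  have hσ : 0 < 1 - σ := sub_pos.2 hrun.sigma_lt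
  refine ⟨(L + 1) / (1 - σ), by positivity, ?_⟩
  filter_upwards [eventually_step_expansion hF hconv zero_lt_one] with k hk
  have hw := (hrun.step_wolfe k).2
  rw [← hrun.next_iterate] at hw
  obtain ⟨j, hj⟩ := exists_inner_eq_maxDirDeriv hm F (x (k + 1)) (d k)
  have h1 := inner_le_maxDirDeriv (F := F) (x := x k) (d := d k) j
  have h2 : ‖grad F j (x (k + 1)) - grad F j (x k)‖ ≤ (L + 1) * (α k * ‖d k‖) := by
    have h3 : ‖grad F j (x (k + 1)) - grad F j (x k)‖ ≤ (L + 1) * ‖x (k + 1) - x k‖ := by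
      have := norm_le_norm_add_norm_sub' (grad F j (x (k + 1)) - grad F j (x k))
        (hess F j x' (x (k + 1) - x k))
      linarith [(hk j).1, hLb j (x (k + 1) - x k)]
    rwa [hrun.step_eq, norm_smul, Real.norm_of_nonneg (hrun.step_pos k).le] at h3
  have h4 := real_inner_le_norm (grad F j (x (k + 1)) - grad F j (x k)) (d k)
  rw [inner_sub_left, hj] at h4
  rw [div_mul_eq_mul_div, le_div_iff₀ hσ]
  nlinarith [mul_le_mul_of_nonneg_right h2 (norm_nonneg (d k))]

end Run

/-! ### R-linear convergence -/

section LinearRate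

/-- `Φ exp (κ Ψ)` shrinks by `exp (-κ / 2)` at every index. When `Γ > 1`, `Φ` may stagnate but `Ψ`
falls enough; both cases fit `Φ (k + 1) ≤ exp (-κ + κ Γ) Φ k`. -/
lemma le_geometric_of_potential {Φ Ψ Γ : ℕ → ℝ} {κ : ℝ} (hκ : 0 < κ) (hΦ : ∀ k, 0 ≤ Φ k)
    (hΨ : ∀ k, 0 ≤ Ψ k) (hΓ : ∀ k, 0 ≤ Γ k) (hstep : ∀ k, Ψ (k + 1) ≤ Ψ k - Γ k + 1 / 2)
    (hmono : ∀ k, Φ (k + 1) ≤ Φ k) (hgood : ∀ k, Γ k ≤ 1 → Φ (k + 1) ≤ Real.exp (-κ) * Φ k)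
    (k : ℕ) : Φ k ≤ Φ 0 * Real.exp (κ * Ψ 0) * Real.exp (-κ / 2) ^ k := by
  have h1 : ∀ k, Φ (k + 1) ≤ Real.exp (-κ + κ * Γ k) * Φ k := fun k => by
    rcases le_or_gt (Γ k) 1 with h | h
    · refine (hgood k h).trans (mul_le_mul_of_nonneg_right (Real.exp_le_exp.2 ?_) (hΦ k))
      have := mul_nonneg hκ.le (hΓ k)
      linarith
    · refine (hmono k).trans (le_mul_of_one_le_left (hΦ k) (Real.one_le_exp ?_))
      nlinarith
  have h2 : ∀ k, Φ k * Real.exp (κ * Ψ k) ≤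
      Φ 0 * Real.exp (κ * Ψ 0) * Real.exp (-κ / 2) ^ k := fun k => by
    induction k with
    | zero => simp
    | succ k ih =>
      calc Φ (k + 1) * Real.exp (κ * Ψ (k + 1))
          ≤ (Real.exp (-κ + κ * Γ k) * Φ k) * Real.exp (κ * (Ψ k - Γ k + 1 / 2)) :=
            mul_le_mul (h1 k) (Real.exp_le_exp.2 (mul_le_mul_of_nonneg_left (hstep k) hκ.le))
              (Real.exp_pos _).le (mul_nonneg (Real.exp_pos _).le (hΦ k))
        _ = (Φ k * Real.exp (κ * Ψ k)) * Real.exp (-κ / 2) := by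
            have : Real.exp (-κ + κ * Γ k) * Real.exp (κ * (Ψ k - Γ k + 1 / 2)) =
                Real.exp (κ * Ψ k) * Real.exp (-κ / 2) := by
              rw [← Real.exp_add, ← Real.exp_add]; ring_nf
            linear_combination Φ k * this
        _ ≤ _ := by
            rw [pow_succ, ← mul_assoc]
            exact mul_le_mul_of_nonneg_right ih (Real.exp_pos _).le
  refine le_trans (le_mul_of_one_le_right (hΦ k) (Real.one_le_exp ?_)) (h2 k)
  exact mul_nonneg hκ.le (hΨ k)

variable {n m : ℕ} {F : Vec n → Vec m} {ρ σ ϑlo ϑhi : ℝ} {x d : ℕ → Vec n} {α : ℕ → ℝ}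
  {μ : ℕ → Fin m → ℝ} {ϑ : ℕ → ℝ} {B : ℕ → Fin m → Matrix (Fin n) (Fin n) ℝ} {x' : Vec n}

/-- The sum of the potentials of the matrices `B k j`, relative to the Hessians at `x'`. -/
def totalPotential (F : Vec n → Vec m) (x' : Vec n)
    (B : ℕ → Fin m → Matrix (Fin n) (Fin n) ℝ) (k : ℕ) : ℝ :=
  ∑ j, bfgsPotential (hessMatrix F j x')⁻¹ (B k j)

/-- The sum over the objectives of the gains above their minimal value `1`. -/
def totalGain (F : Vec n → Vec m) (x' : Vec n) (B : ℕ → Fin m → Matrix (Fin n) (Fin n) ℝ)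
    (x : ℕ → Vec n) (k : ℕ) : ℝ :=
  ∑ j, (bfgsGain (hessMatrix F j x') (B k j) (x (k + 1) - x k) - 1)

lemma IsRun.totalPotential_nonneg (hrun : IsRun F ρ σ ϑlo ϑhi x d α μ ϑ B) (hm : 0 < m)
    (hF : ContDiff ℝ 2 F) (hG : ∀ j, (hessMatrix F j x').PosDef) (k : ℕ) :
    0 ≤ totalPotential F x' B k :=
  Finset.sum_nonneg fun j _ => bfgsPotential_nonneg (hG j).inv (hrun.posDef hm hF k j)

lemma IsRun.bfgsPotential_le_total (hrun : IsRun F ρ σ ϑlo ϑhi x d α μ ϑ B) (hm : 0 < m)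
    (hF : ContDiff ℝ 2 F) (hG : ∀ j, (hessMatrix F j x').PosDef) (k : ℕ) (j : Fin m) :
    bfgsPotential (hessMatrix F j x')⁻¹ (B k j) ≤ totalPotential F x' B k :=
  Finset.single_le_sum (f := fun j => bfgsPotential (hessMatrix F j x')⁻¹ (B k j))
    (fun j _ => bfgsPotential_nonneg (hG j).inv (hrun.posDef hm hF k j)) (Finset.mem_univ j)

lemma IsRun.totalGain_nonneg (hrun : IsRun F ρ σ ϑlo ϑhi x d α μ ϑ B) (hm : 0 < m)
    (hF : ContDiff ℝ 2 F) (hG : ∀ j, (hessMatrix F j x').PosDef) (k : ℕ) :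
    0 ≤ totalGain F x' B x k :=
  Finset.sum_nonneg fun j _ => sub_nonneg.2
    (one_le_bfgsGain (hG j) (hrun.posDef hm hF k j) (hrun.step_ne_zero hm hF k))

lemma IsRun.bfgsGain_sub_one_le_total (hrun : IsRun F ρ σ ϑlo ϑhi x d α μ ϑ B) (hm : 0 < m)
    (hF : ContDiff ℝ 2 F) (hG : ∀ j, (hessMatrix F j x').PosDef) (k : ℕ) (j : Fin m) :
    bfgsGain (hessMatrix F j x') (B k j) (x (k + 1) - x k) - 1 ≤ totalGain F x' B x k :=
  Finset.single_le_sum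
    (f := fun j => bfgsGain (hessMatrix F j x') (B k j) (x (k + 1) - x k) - 1)
    (fun j _ => sub_nonneg.2
      (one_le_bfgsGain (hG j) (hrun.posDef hm hF k j) (hrun.step_ne_zero hm hF k)))
    (Finset.mem_univ j)

lemma IsRun.exists_totalPotential_succ_le (hrun : IsRun F ρ σ ϑlo ϑhi x d α μ ϑ B) (hm : 0 < m)
    (hF : ContDiff ℝ 2 F) (hG : ∀ j, (hessMatrix F j x').PosDef) :
    ∃ C > 0, ∃ ε₀ > 0, ∀ k ε, 0 ≤ ε → ε ≤ ε₀ →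
      (∀ j, ‖gam F (μ k) (ϑ k) j (x k) (x (k + 1)) - hess F j x' (x (k + 1) - x k)‖
        ≤ ε * ‖x (k + 1) - x k‖) →
      totalPotential F x' B (k + 1) ≤
        totalPotential F x' B k - totalGain F x' B x k + C * ε ^ 2 := by
  choose C hC ε₁ hε₁ h using fun j => exists_curvature_error_le (hG j)
  obtain ⟨ε₀, hε₀, hle⟩ := exists_pos_forall_of_antitone (P := fun j e => e ≤ ε₁ j)
    (fun j c c' _ h1 h2 => h1.trans h2) fun j => ⟨ε₁ j, hε₁ j, le_rfl⟩
  refine ⟨∑ j, C j, Finset.sum_pos (fun j _ => hC j) ⟨⟨0, hm⟩, Finset.mem_univ _⟩, ε₀, hε₀,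
    fun k ε h0 hε hk => ?_⟩
  rw [totalPotential, totalPotential, totalGain, ← Finset.sum_sub_distrib, Finset.sum_mul,
    ← Finset.sum_add_distrib]
  refine Finset.sum_le_sum fun j _ => ?_
  have hs := hrun.step_ne_zero hm hF k
  obtain ⟨h1, h2⟩ := h j _ (gam F (μ k) (ϑ k) j (x k) (x (k + 1))) ε hs h0 (hε.trans (hle j)) (by
    have h3 := hk j
    rw [hessMatrix_mulVec, ← WithLp.ofLp_sub, ← inner_eq_dotProduct, ← inner_eq_dotProduct,
      real_inner_self_eq_norm_sq, real_inner_self_eq_norm_sq, ← mul_pow]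
    gcongr)
  rw [hrun.next_matrix, bfgsPotential_update (hG j) (hrun.posDef hm hF k j) hs h1]
  linarith

lemma IsRun.exists_bounds_of_totalGain_le (hrun : IsRun F ρ σ ϑlo ϑhi x d α μ ϑ B) (hm : 0 < m)
    (hF : ContDiff ℝ 2 F) (hG : ∀ j, (hessMatrix F j x').PosDef) :
    ∃ c > 0, ∃ C > 0, ∀ k, totalGain F x' B x k ≤ 1 → ∀ j,
      c * ‖d k‖ ^ 2 ≤ (d k).ofLp ⬝ᵥ (B k j *ᵥ (d k).ofLp) ∧
      ‖(WithLp.toLp 2 (B k j *ᵥ (d k).ofLp) : Vec n)‖ ^ 2 ≤ C * ‖d k‖ ^ 2 := by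
  -- The bound 2 is the minimal gain 1 plus the permitted excess 1. The resulting bounds pass from
  -- `s` to `d k` by homogeneity.
  choose c hc C hC h using fun j => exists_bounds_of_bfgsGain_le (hG j) 2
  obtain ⟨c₀, hc₀, hcl⟩ := exists_pos_forall_of_antitone (P := fun j e => e ≤ c j)
    (fun j c c' _ h1 h2 => h1.trans h2) fun j => ⟨c j, hc j, le_rfl⟩
  obtain ⟨C₀, hC₀, hCl⟩ := exists_pos_forall_of_monotone (P := fun j e => C j ≤ e)
    (fun j c c' h1 h2 => h2.trans h1) fun j => ⟨C j, hC j, le_rfl⟩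
  refine ⟨c₀, hc₀, C₀, hC₀, fun k hk j => ?_⟩
  have h1 := hrun.bfgsGain_sub_one_le_total hm hF hG k j
  obtain ⟨h2, h3⟩ := h j _ _ (hrun.posDef hm hF k j) (hrun.step_ne_zero hm hF k) (by linarith)
  have hα : 0 < α k ^ 2 := by have := hrun.step_pos k; positivity
  rw [hrun.step_eq] at h2 h3
  simp only [WithLp.ofLp_smul, mulVec_smul, dotProduct_smul, smul_dotProduct, smul_eq_mul] at h2 h3
  rw [← real_inner_self_eq_norm_sq, ← real_inner_self_eq_norm_sq, inner_eq_dotProduct,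
    inner_eq_dotProduct]
  have h4 := dotProduct_self_nonneg_real (d k).ofLp
  constructor
  · refine (mul_le_mul_of_nonneg_right (hcl j) h4).trans (le_of_mul_le_mul_left ?_ hα)
    linarith
  · refine le_trans (le_of_mul_le_mul_left ?_ hα) (mul_le_mul_of_nonneg_right (hCl j) h4)
    linarith

lemma norm_gam_sub_le {μ : Fin m → ℝ} {t : ℝ} (ht : 0 ≤ t) {j : Fin m} {y z : Vec n} {ε : ℝ}
    (h : ‖grad F j z - grad F j y - hess F j x' (z - y)‖ ≤ ε * ‖z - y‖) :
    ‖gam F μ t j y z - hess F j x' (z - y)‖ ≤ (ε + corr F μ t j y z) * ‖z - y‖ := by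
  rw [gam, add_sub_right_comm, add_mul]
  refine (norm_add_le _ _).trans (add_le_add h ?_)
  rw [norm_smul, Real.norm_of_nonneg (corr_nonneg ht j y z)]

/-- The smallest excess of an objective value at iteration `k` over its value at `x'`. -/
def minGap (F : Vec n → Vec m) (x' : Vec n) (x : ℕ → Vec n) (k : ℕ) : ℝ :=
  ⨅ j : Fin m, (F (x k) j - F x' j)

lemma minGap_le (j : Fin m) (k : ℕ) : minGap F x' x k ≤ F (x k) j - F x' j :=
  ciInf_le (f := fun j => F (x k) j - F x' j) (Set.finite_range _).bddBelow j

lemma exists_minGap_eq (hm : 0 < m) (F : Vec n → Vec m) (x' : Vec n) (x : ℕ → Vec n) (k : ℕ) :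
    ∃ j, F (x k) j - F x' j = minGap F x' x k :=
  have : Nonempty (Fin m) := ⟨⟨0, hm⟩⟩
  exists_eq_ciInf_of_finite (f := fun j => F (x k) j - F x' j)

lemma IsRun.minGap_pos (hrun : IsRun F ρ σ ϑlo ϑhi x d α μ ϑ B) (hm : 0 < m)
    (hF : ContDiff ℝ 2 F) (hconv : Tendsto x atTop (𝓝 x')) (k : ℕ) : 0 < minGap F x' x k := by
  obtain ⟨j, hj⟩ := exists_minGap_eq hm F x' x k
  rw [← hj]
  exact sub_pos.2 (hrun.value_lt hm hF hconv k j)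

lemma IsRun.minGap_succ_le (hrun : IsRun F ρ σ ϑlo ϑhi x d α μ ϑ B) (hm : 0 < m) (k : ℕ) :
    minGap F x' x (k + 1) ≤ minGap F x' x k - decrease F ρ x d α k := by
  obtain ⟨j, hj⟩ := exists_minGap_eq hm F x' x k
  have h1 := minGap_le (F := F) (x' := x') (x := x) j (k + 1)
  linarith [hrun.value_succ_le k j]

/-- A Polyak–Łojasiewicz inequality: the smallest gap is below any convex combination of gaps, and
local strong convexity bounds that by the squared combined gradient. -/
lemma exists_minGap_le (hF : ContDiff ℝ 2 F) (hconv : Tendsto x atTop (𝓝 x'))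
    (hpos : ∀ j, ∀ z : Vec n, z ≠ 0 → 0 < inner ℝ z (hess F j x' z)) :
    ∃ C > 0, ∀ᶠ k in atTop, ∀ w ∈ stdSimplex ℝ (Fin m),
      minGap F x' x k ≤ C * ‖∑ j, w j • grad F j (x k)‖ ^ 2 := by
  obtain ⟨c, hc, L, hL, hb⟩ := exists_hess_bounds hF hpos
  obtain ⟨r, hr, h⟩ := exists_ball_expansion hF x' (show 0 < c / 4 by positivity)
  refine ⟨1 / c, by positivity, ?_⟩
  filter_upwards [hconv.eventually (Metric.ball_mem_nhds x' hr)] with k hk w hw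
  have h1 : ∀ j, F (x k) j - F x' j ≤
      -inner ℝ (grad F j (x k)) (x' - x k) - c / 4 * ‖x' - x k‖ ^ 2 := fun j => by
    have h2 := (abs_le.1 (h _ hk _ (Metric.mem_ball_self hr) j).2).1
    have h3 := (hb j (x' - x k)).1
    linarith
  have h4 : minGap F x' x k ≤ ∑ j, w j * (F (x k) j - F x' j) :=
    le_sum_mul_of_stdSimplex hw fun j => minGap_le j k
  have h5 : ∑ j, w j * (F (x k) j - F x' j) ≤
      -inner ℝ (∑ j, w j • grad F j (x k)) (x' - x k) - c / 4 * ‖x' - x k‖ ^ 2 := by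
    refine (Finset.sum_le_sum fun j _ => mul_le_mul_of_nonneg_left (h1 j) (hw.1 j)).trans ?_
    simp only [mul_sub, Finset.sum_sub_distrib, ← Finset.sum_mul, hw.2, one_mul, sum_inner,
      real_inner_smul_left, mul_neg, Finset.sum_neg_distrib, le_refl]
  have h6 := (abs_le.1 (abs_real_inner_le_norm (∑ j, w j • grad F j (x k)) (x' - x k))).1
  rw [div_mul_eq_mul_div, le_div_iff₀ hc]
  nlinarith [sq_nonneg (c / 2 * ‖x' - x k‖ - ‖∑ j, w j • grad F j (x k)‖)]

/-- On a good iteration the step size is at least `c / L`, so the decrease is of order `‖d‖²`.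
Stationarity bounds a combined gradient by a multiple of `‖d‖`, and the Polyak–Łojasiewicz
inequality turns this into a fixed fraction of the gap. -/
lemma IsRun.exists_minGap_contraction (hrun : IsRun F ρ σ ϑlo ϑhi x d α μ ϑ B) (hm : 0 < m)
    (hF : ContDiff ℝ 2 F) (hconv : Tendsto x atTop (𝓝 x'))
    (hpos : ∀ j, ∀ z : Vec n, z ≠ 0 → 0 < inner ℝ z (hess F j x' z)) :
    ∃ κ > 0, ∀ᶠ k in atTop, totalGain F x' B x k ≤ 1 →
      minGap F x' x (k + 1) ≤ Real.exp (-κ) * minGap F x' x k := by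
  have hG : ∀ j, (hessMatrix F j x').PosDef := fun j => hessMatrix_posDef hF (hpos j)
  obtain ⟨c, hc, C, hC, hb⟩ := hrun.exists_bounds_of_totalGain_le hm hF hG
  obtain ⟨L, hL, hLb⟩ := hrun.exists_neg_maxDirDeriv_le hm hF hconv
  obtain ⟨K, hK, hKb⟩ := exists_minGap_le hF hconv hpos
  have hρ := hrun.rho_pos
  refine ⟨ρ * (c / L) * c / (K * C), by positivity, ?_⟩
  filter_upwards [hLb, hKb] with k hLk hKk hgood
  obtain ⟨w, hw, h0, -⟩ := exists_multiplier hm (hrun.isHermitian hm hF k) (hrun.direction k)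
  have hd : 0 < ‖d k‖ ^ 2 := by
    have := norm_pos_iff.2 (hrun.dir_ne_zero hm hF k); positivity
  have h1 := maxDirDeriv_le_neg hm (hrun.isHermitian hm hF k) (hrun.direction k)
    fun j => (hb k hgood j).1
  have hα : c / L ≤ α k := by
    rw [div_le_iff₀ hL]
    have : c * ‖d k‖ ^ 2 ≤ (α k * L) * ‖d k‖ ^ 2 := by linarith
    exact le_of_mul_le_mul_right this hd
  have h2 : ρ * (c / L) * (c * ‖d k‖ ^ 2) ≤ decrease F ρ x d α k := by
    rw [decrease, ← mul_neg]
    have := hrun.step_pos k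
    have h3 : c * ‖d k‖ ^ 2 ≤ -maxDirDeriv F (x k) (d k) := by linarith
    gcongr
  have h4 : ‖∑ j, w j • grad F j (x k)‖ ^ 2 ≤ C * ‖d k‖ ^ 2 := by
    have h5 : ∑ j, w j • grad F j (x k) =
        -∑ j, w j • (WithLp.toLp 2 (B k j *ᵥ (d k).ofLp) : Vec n) := by
      rw [eq_neg_iff_add_eq_zero, ← Finset.sum_add_distrib, ← h0]
      simp only [smul_add]
    rw [h5, norm_neg]
    have h6 : ‖∑ j, w j • (WithLp.toLp 2 (B k j *ᵥ (d k).ofLp) : Vec n)‖ ≤ √(C * ‖d k‖ ^ 2) :=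
      norm_sum_smul_le_of_stdSimplex hw fun j => Real.le_sqrt_of_sq_le (hb k hgood j).2
    calc _ ≤ √(C * ‖d k‖ ^ 2) ^ 2 := by gcongr
      _ = _ := Real.sq_sqrt (by positivity)
  have h7 := hKk w hw
  have h8 : ρ * (c / L) * c / (K * C) * minGap F x' x k ≤ decrease F ρ x d α k := by
    refine le_trans ?_ h2
    calc ρ * (c / L) * c / (K * C) * minGap F x' x k
        ≤ ρ * (c / L) * c / (K * C) * (K * (C * ‖d k‖ ^ 2)) := by
          gcongr
          exact h7.trans (by gcongr)
      _ = _ := by field_simp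
  have h9 := hrun.minGap_succ_le (x' := x') hm k
  have h10 := Real.add_one_le_exp (-(ρ * (c / L) * c / (K * C)))
  nlinarith [mul_le_mul_of_nonneg_right h10 (hrun.minGap_pos hm hF hconv k).le]

lemma IsRun.exists_linear_rate (hrun : IsRun F ρ σ ϑlo ϑhi x d α μ ϑ B) (hm : 0 < m)
    (hF : ContDiff ℝ 2 F) (hconv : Tendsto x atTop (𝓝 x'))
    (hpos : ∀ j, ∀ z : Vec n, z ≠ 0 → 0 < inner ℝ z (hess F j x' z))
    (hsum : ∀ j, Summable fun k => corr F (μ k) (ϑ k) j (x k) (x (k + 1))) :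
    ∃ N : ℕ, ∃ C > 0, ∃ r > 0, r < 1 ∧ ∀ i, ‖x (N + i) - x'‖ ≤ C * r ^ i := by
  have hG : ∀ j, (hessMatrix F j x').PosDef := fun j => hessMatrix_posDef hF (hpos j)
  obtain ⟨κ, hκ, hcontr⟩ := hrun.exists_minGap_contraction hm hF hconv hpos
  obtain ⟨K, hK, hstep⟩ := hrun.exists_sq_step_le hm hF hconv hpos
  obtain ⟨C, hC, ε₀, hε₀, hpot⟩ := hrun.exists_totalPotential_succ_le hm hF hG
  obtain ⟨ε, hε, hεε, hCε⟩ : ∃ ε > 0, ε ≤ ε₀ ∧ C * ε ^ 2 ≤ 1 / 2 := by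
    have h1 : ∀ᶠ ε : ℝ in 𝓝 0, C * ε ^ 2 < 1 / 2 :=
      ((by fun_prop : Continuous fun ε : ℝ => C * ε ^ 2).tendsto' 0 0 (by simp)).eventually
        (gt_mem_nhds (by norm_num))
    obtain ⟨ε, h2, h3⟩ := ((h1.filter_mono nhdsWithin_le_nhds).and (Ioc_mem_nhdsGT hε₀)).exists
    exact ⟨ε, h3.1, h3.2, h2.le⟩
  have hcorr : ∀ᶠ k in atTop, ∀ j, corr F (μ k) (ϑ k) j (x k) (x (k + 1)) < ε / 2 :=
    eventually_all.2 fun j => (hsum j).tendsto_atTop_zero.eventually (gt_mem_nhds (half_pos hε))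
  obtain ⟨N, hN⟩ := eventually_atTop.1 (hcontr.and (hstep.and (hcorr.and
    (eventually_step_expansion hF hconv (half_pos hε)))))
  have hlin := le_geometric_of_potential (Φ := fun i => minGap F x' x (N + i))
    (Ψ := fun i => totalPotential F x' B (N + i)) (Γ := fun i => totalGain F x' B x (N + i)) hκ
    (fun i => (hrun.minGap_pos hm hF hconv _).le)
    (fun i => hrun.totalPotential_nonneg hm hF hG _) (fun i => hrun.totalGain_nonneg hm hF hG _)
    (fun i => by
      obtain ⟨-, -, h3, h4⟩ := hN (N + i) (Nat.le_add_right _ _)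
      refine (hpot (N + i) ε hε.le hεε fun j => ?_).trans (by linarith)
      refine (norm_gam_sub_le (hrun.scalar_pos _).le (h4 j).1).trans ?_
      gcongr
      linarith [h3 j])
    (fun i => by
      have := hrun.minGap_succ_le (x' := x') hm (N + i)
      have h2 := hrun.decrease_pos hm hF (N + i)
      simp only [← add_assoc]
      linarith)
    (fun i hi => (hN (N + i) (Nat.le_add_right _ _)).1 hi)
  set A := minGap F x' x (N + 0) * Real.exp (κ * totalPotential F x' B (N + 0))
  have hA : 0 < A := mul_pos (hrun.minGap_pos hm hF hconv _) (Real.exp_pos _)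
  set r := Real.exp (-κ / 2)
  have hr : 0 < r := Real.exp_pos _
  have hr1 : √r < 1 := by
    rw [Real.sqrt_lt' one_pos, one_pow]
    exact Real.exp_lt_one_iff.2 (by linarith)
  -- Squared steps are bounded by the decrease, hence by the gap, so distances inherit the ratio
  -- `√r`.
  have hs : ∀ i, dist (x (N + i)) (x (N + (i + 1))) ≤ √(K * A) * √r ^ i := fun i => by
    obtain ⟨-, h2, -, -⟩ := hN (N + i) (Nat.le_add_right _ _)
    have h3 := hrun.minGap_succ_le (x' := x') hm (N + i)
    have h4 := hrun.minGap_pos hm hF hconv (N + i + 1)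
    have h5 := hlin i
    rw [dist_comm, dist_eq_norm, ← add_assoc]
    refine abs_le_of_sq_le_sq' ?_ (by positivity) |>.2
    rw [mul_pow, Real.sq_sqrt (by positivity), ← pow_mul, mul_comm i 2, pow_mul,
      Real.sq_sqrt hr.le, mul_assoc]
    exact h2.trans (by gcongr; linarith)
  have hlim : Tendsto (fun i => x (N + i)) atTop (𝓝 x') :=
    hconv.comp (tendsto_add_atTop_nat N |>.congr fun i => add_comm _ _)
  have hpos1 : 0 < 1 - √r := sub_pos.2 hr1
  refine ⟨N, √(K * A) / (1 - √r), by positivity, √r, by positivity, hr1, fun i => ?_⟩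
  have h := dist_le_of_le_geometric_of_tendsto (√r) (√(K * A)) hr1 hs hlim i
  rw [← dist_eq_norm]
  exact h.trans_eq (by ring)

end LinearRate

/-! ### Dennis–Moré condition, unit steps and superlinear convergence -/

section SuperlinearRate

lemma bounded_and_tendsto_of_summable_error {Ψ Γ e : ℕ → ℝ} (hΨ : ∀ k, 0 ≤ Ψ k)
    (hΓ : ∀ k, 0 ≤ Γ k) (he : ∀ k, 0 ≤ e k) (hsum : Summable e)
    (hstep : ∀ k, Ψ (k + 1) ≤ Ψ k - Γ k + e k) :
    (∀ k, Ψ k ≤ Ψ 0 + ∑' i, e i) ∧ Tendsto Γ atTop (𝓝 0) := by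
  have h1 : ∀ k, Ψ k + ∑ i ∈ Finset.range k, Γ i ≤ Ψ 0 + ∑ i ∈ Finset.range k, e i := fun k => by
    induction k with
    | zero => simp
    | succ k ih =>
      rw [Finset.sum_range_succ, Finset.sum_range_succ]
      linarith [hstep k]
  have h2 : ∀ k, Ψ k + ∑ i ∈ Finset.range k, Γ i ≤ Ψ 0 + ∑' i, e i := fun k =>
    (h1 k).trans (by linarith [hsum.sum_le_tsum (Finset.range k) fun i _ => he i])
  refine ⟨fun k => ?_, ?_⟩
  · linarith [h2 k, Finset.sum_nonneg fun i (_ : i ∈ Finset.range k) => hΓ i]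
  · exact (summable_of_sum_range_le (c := Ψ 0 + ∑' i, e i) hΓ fun k => by
      linarith [h2 k, hΨ k]).tendsto_atTop_zero

variable {n m : ℕ} {F : Vec n → Vec m} {ρ σ ϑlo ϑhi : ℝ} {x d : ℕ → Vec n} {α : ℕ → ℝ}
  {μ : ℕ → Fin m → ℝ} {ϑ : ℕ → ℝ} {B : ℕ → Fin m → Matrix (Fin n) (Fin n) ℝ} {x' : Vec n}

lemma IsRun.exists_summable_deviation (hrun : IsRun F ρ σ ϑlo ϑhi x d α μ ϑ B) (hm : 0 < m)
    (hF : ContDiff ℝ 2 F) (hconv : Tendsto x atTop (𝓝 x'))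
    (hpos : ∀ j, ∀ z : Vec n, z ≠ 0 → 0 < inner ℝ z (hess F j x' z))
    {ν M : ℝ} (hν : 0 < ν) (hM : 0 < M)
    (hholder : ∀ᶠ y in 𝓝 x', ∀ j, ‖hess F j y - hess F j x'‖ ≤ M * ‖y - x'‖ ^ ν)
    (hsum : ∀ j, Summable fun k => corr F (μ k) (ϑ k) j (x k) (x (k + 1))) :
    ∃ e : ℕ → ℝ, Summable e ∧ (∀ k, 0 ≤ e k) ∧ ∀ᶠ k in atTop, ∀ j,
      ‖gam F (μ k) (ϑ k) j (x k) (x (k + 1)) - hess F j x' (x (k + 1) - x k)‖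
        ≤ e k * ‖x (k + 1) - x k‖ := by
  obtain ⟨N, C, hC, r, hr, hr1, hlin⟩ := hrun.exists_linear_rate hm hF hconv hpos hsum
  obtain ⟨R, hR, hhol⟩ := exists_ball_holder hF hν hM hholder
  have hc : ∀ k j, 0 ≤ corr F (μ k) (ϑ k) j (x k) (x (k + 1)) := fun k j =>
    corr_nonneg (hrun.scalar_pos k).le j _ _
  -- The Hölder part is geometric with ratio `r ^ ν` from `N` on; truncated subtraction only affects
  -- the finitely many earlier terms.
  refine ⟨fun k => M * (C * r ^ (k - N)) ^ ν
    + ∑ j, corr F (μ k) (ϑ k) j (x k) (x (k + 1)), ?_, fun k => ?_, ?_⟩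
  · refine Summable.add ?_ (summable_sum fun j _ => hsum j)
    rw [← summable_nat_add_iff N]
    have h1 : (fun k => M * (C * r ^ (k + N - N)) ^ ν) = fun k => M * C ^ ν * (r ^ ν) ^ k := by
      funext k
      rw [Nat.add_sub_cancel, Real.mul_rpow hC.le (by positivity), Real.rpow_pow_comm hr.le]
      ring
    rw [h1]
    exact (summable_geometric_of_lt_one (by positivity)
      (Real.rpow_lt_one hr.le hr1 hν)).mul_left _
  · have := Finset.sum_nonneg fun j (_ : j ∈ Finset.univ) => hc k j
    positivity
  · have h1 : Tendsto (fun i => C * r ^ i) atTop (𝓝 0) := by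
      simpa using (tendsto_pow_atTop_nhds_zero_of_lt_one hr.le hr1).const_mul C
    have h2 : ∀ᶠ k in atTop, C * r ^ (k - N) < R :=
      (tendsto_sub_atTop_nat N).eventually (h1.eventually (gt_mem_nhds hR))
    filter_upwards [h2, eventually_ge_atTop N] with k hk hkN j
    obtain ⟨i, rfl⟩ := Nat.exists_eq_add_of_le hkN
    rw [Nat.add_sub_cancel_left] at hk ⊢
    have h3 : x (N + i) ∈ Metric.closedBall x' (C * r ^ i) := by
      rw [mem_closedBall_iff_norm]; exact hlin i
    have h4 : x (N + i + 1) ∈ Metric.closedBall x' (C * r ^ i) := by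
      rw [mem_closedBall_iff_norm]
      refine (hlin (i + 1)).trans ?_
      exact mul_le_mul_of_nonneg_left (pow_le_pow_of_le_one hr.le hr1.le i.le_succ) hC.le
    refine (norm_gam_sub_le (hrun.scalar_pos _).le (hhol _ hk _ h3 _ h4 j)).trans ?_
    gcongr
    exact Finset.single_le_sum (fun j _ => hc (N + i) j) (Finset.mem_univ j)

lemma IsRun.exists_potential_bound (hrun : IsRun F ρ σ ϑlo ϑhi x d α μ ϑ B) (hm : 0 < m)
    (hF : ContDiff ℝ 2 F) (hG : ∀ j, (hessMatrix F j x').PosDef) {e : ℕ → ℝ} (he : Summable e)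
    (he0 : ∀ k, 0 ≤ e k) (hdev : ∀ᶠ k in atTop, ∀ j,
      ‖gam F (μ k) (ϑ k) j (x k) (x (k + 1)) - hess F j x' (x (k + 1) - x k)‖
        ≤ e k * ‖x (k + 1) - x k‖) :
    (∃ K, ∀ᶠ k in atTop, totalPotential F x' B k ≤ K) ∧
      Tendsto (totalGain F x' B x) atTop (𝓝 0) := by
  obtain ⟨C, hC, ε₀, hε₀, hpot⟩ := hrun.exists_totalPotential_succ_le hm hF hG
  have h1 := he.tendsto_atTop_zero.eventually (gt_mem_nhds (lt_min hε₀ one_pos))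
  obtain ⟨N, hN⟩ := eventually_atTop.1 (hdev.and h1)
  obtain ⟨h2, h3⟩ := bounded_and_tendsto_of_summable_error
    (Ψ := fun i => totalPotential F x' B (i + N)) (Γ := fun i => totalGain F x' B x (i + N))
    (e := fun i => C * e (i + N)) (fun i => hrun.totalPotential_nonneg hm hF hG _)
    (fun i => hrun.totalGain_nonneg hm hF hG _) (fun i => mul_nonneg hC.le (he0 _))
    (((summable_nat_add_iff N).2 he).mul_left C)
    (fun i => by
      obtain ⟨h4, h5⟩ := hN (i + N) (Nat.le_add_left _ _)
      rw [lt_min_iff] at h5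
      have h6 := hpot (i + N) (e (i + N)) (he0 _) h5.1.le h4
      rw [add_right_comm]
      -- Past `N` the deviations are below 1, so summability of `e` controls the quadratic errors.
      have h7 : e (i + N) ^ 2 ≤ e (i + N) := by nlinarith [he0 (i + N)]
      linarith [mul_le_mul_of_nonneg_left h7 hC.le])
  refine ⟨⟨totalPotential F x' B (0 + N) + ∑' i, C * e (i + N),
    eventually_atTop.2 ⟨N, fun k hk => ?_⟩⟩, (tendsto_add_atTop_iff_nat N).1 h3⟩
  obtain ⟨i, rfl⟩ := Nat.exists_eq_add_of_le' hk
  exact h2 i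

lemma IsRun.exists_matrix_lower_bound (hrun : IsRun F ρ σ ϑlo ϑhi x d α μ ϑ B) (hm : 0 < m)
    (hF : ContDiff ℝ 2 F) (hG : ∀ j, (hessMatrix F j x').PosDef) {K : ℝ}
    (hK : ∀ᶠ k in atTop, totalPotential F x' B k ≤ K) :
    ∃ c > 0, ∀ᶠ k in atTop, ∀ j, ∀ v : Vec n,
      c * ‖v‖ ^ 2 ≤ v.ofLp ⬝ᵥ (B k j *ᵥ v.ofLp) := by
  choose c hc h using fun j => exists_pos_mul_le_of_bfgsPotential_le (hG j).inv K
  obtain ⟨c₀, hc₀, hcl⟩ := exists_pos_forall_of_antitone (P := fun j e => e ≤ c j)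
    (fun j c c' _ h1 h2 => h1.trans h2) fun j => ⟨c j, hc j, le_rfl⟩
  refine ⟨c₀, hc₀, ?_⟩
  filter_upwards [hK] with k hk j v
  have h1 := h j (B k j) (hrun.posDef hm hF k j)
    ((hrun.bfgsPotential_le_total hm hF hG k j).trans hk) v.ofLp
  rw [← real_inner_self_eq_norm_sq, inner_eq_dotProduct]
  exact (mul_le_mul_of_nonneg_right (hcl j) (dotProduct_self_nonneg_real _)).trans h1

/-- The Dennis–Moré condition along the directions. -/
lemma IsRun.eventually_dennisMore (hrun : IsRun F ρ σ ϑlo ϑhi x d α μ ϑ B) (hm : 0 < m)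
    (hF : ContDiff ℝ 2 F) (hG : ∀ j, (hessMatrix F j x').PosDef)
    (hgain : Tendsto (totalGain F x' B x) atTop (𝓝 0)) {ε : ℝ} (hε : 0 < ε) :
    ∀ᶠ k in atTop, ∀ j,
      ‖WithLp.toLp 2 (B k j *ᵥ (d k).ofLp) - hess F j x' (d k)‖ ≤ ε * ‖d k‖ := by
  choose C hC h using fun j => exists_residual_le_of_bfgsGain_le (hG j)
  obtain ⟨C₀, hC₀, hCl⟩ := exists_pos_forall_of_monotone (P := fun j e => C j ≤ e)
    (fun j c c' h1 h2 => h2.trans h1) fun j => ⟨C j, hC j, le_rfl⟩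
  have hδ : 0 < min 1 (ε ^ 2 / C₀) := by positivity
  filter_upwards [hgain.eventually (gt_mem_nhds hδ)] with k hk j
  rw [lt_min_iff] at hk
  have h1 := hrun.bfgsGain_sub_one_le_total hm hF hG k j
  have hB := hrun.posDef hm hF k j
  have hs := hrun.step_ne_zero hm hF k
  have h2 := h j _ _ hB hs (by linarith)
  have h3 := one_le_bfgsGain (hG j) hB hs
  set g := bfgsGain (hessMatrix F j x') (B k j) (x (k + 1) - x k)
  have h4 : C j * (g - 1) ≤ ε ^ 2 := by
    have : C₀ * totalGain F x' B x k ≤ ε ^ 2 := by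
      have := hk.2.le
      rwa [le_div_iff₀' hC₀] at this
    refine le_trans ?_ this
    exact mul_le_mul (hCl j) h1 (by linarith) hC₀.le
  have hα : 0 < α k ^ 2 := by have := hrun.step_pos k; positivity
  rw [hrun.step_eq] at h2
  simp only [WithLp.ofLp_smul, mulVec_smul, ← smul_sub, dotProduct_smul, smul_dotProduct,
    smul_eq_mul] at h2
  refine abs_le_of_sq_le_sq' ?_ (by positivity) |>.2
  rw [mul_pow, ← real_inner_self_eq_norm_sq, ← real_inner_self_eq_norm_sq, inner_eq_dotProduct,
    inner_eq_dotProduct, WithLp.ofLp_sub, ← hessMatrix_mulVec]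
  have h5 := dotProduct_self_nonneg_real (d k).ofLp
  refine le_trans (le_of_mul_le_mul_left ?_ hα) (mul_le_mul_of_nonneg_right h4 h5)
  linarith

lemma IsRun.tendsto_dir_zero (hrun : IsRun F ρ σ ϑlo ϑhi x d α μ ϑ B) (hm : 0 < m)
    (hF : ContDiff ℝ 2 F) (hconv : Tendsto x atTop (𝓝 x')) {c : ℝ} (hc : 0 < c)
    (hB : ∀ᶠ k in atTop, ∀ j, ∀ v : Vec n, c * ‖v‖ ^ 2 ≤ v.ofLp ⬝ᵥ (B k j *ᵥ v.ofLp)) :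
    Tendsto d atTop (𝓝 0) := by
  obtain ⟨L, hL, hLb⟩ := hrun.exists_neg_maxDirDeriv_le hm hF hconv
  have h1 : Tendsto (fun k => L / c * ‖x (k + 1) - x k‖) atTop (𝓝 0) := by
    simpa using (tendsto_step_zero hconv).norm.const_mul (L / c)
  refine squeeze_zero_norm' ?_ h1
  filter_upwards [hB, hLb] with k hBk hLk
  have h2 := maxDirDeriv_le_neg hm (hrun.isHermitian hm hF k) (hrun.direction k)
    fun j => hBk j (d k)
  have hd : 0 < ‖d k‖ := norm_pos_iff.2 (hrun.dir_ne_zero hm hF k)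
  rw [hrun.step_eq, norm_smul, Real.norm_of_nonneg (hrun.step_pos k).le, div_mul_eq_mul_div,
    le_div_iff₀ hc]
  have h3 : (c * ‖d k‖) * ‖d k‖ ≤ (L * (α k * ‖d k‖)) * ‖d k‖ := by linarith
  linarith [le_of_mul_le_mul_right h3 hd]

/-- Near the end of the run, trial points of unit steps satisfy the second order expansion. -/
lemma eventually_unit_step_expansion (hF : ContDiff ℝ 2 F) (hconv : Tendsto x atTop (𝓝 x'))
    (hd : Tendsto d atTop (𝓝 0)) {ε : ℝ} (hε : 0 < ε) : ∀ᶠ k in atTop, ∀ j,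
      ‖grad F j (x k + d k) - grad F j (x k) - hess F j x' (d k)‖ ≤ ε * ‖d k‖ ∧
      |F (x k + d k) j - F (x k) j - inner ℝ (grad F j (x k)) (d k)
        - 1 / 2 * inner ℝ (hess F j x' (d k)) (d k)| ≤ ε * ‖d k‖ ^ 2 := by
  obtain ⟨r, hr, h⟩ := exists_ball_expansion hF x' hε
  have h2 : Tendsto (fun k => x k + d k) atTop (𝓝 x') := by simpa using hconv.add hd
  filter_upwards [hconv.eventually (Metric.ball_mem_nhds x' hr),
    h2.eventually (Metric.ball_mem_nhds x' hr)] with k hk hk1 j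
  simpa using h _ hk _ hk1 j

lemma inner_hess_sub_le {u v w : Vec n} {b : ℝ} {ε : ℝ} (hb : inner ℝ u v = b)
    (h : ‖u - w‖ ≤ ε * ‖v‖) : |b - inner ℝ w v| ≤ ε * ‖v‖ ^ 2 := by
  rw [← hb, ← inner_sub_left]
  refine (abs_real_inner_le_norm _ _).trans ?_
  nlinarith [mul_le_mul_of_nonneg_right h (norm_nonneg v)]

/-- The change in `F_j` equals its model piece up to `o(‖d‖²)`, and the model value is at most `𝒟 /
2`; the margin `1/2 - ρ` absorbs the error because `-𝒟 ≥ c ‖d‖²`. -/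
lemma IsRun.eventually_wolfe_one (hrun : IsRun F ρ σ ϑlo ϑhi x d α μ ϑ B) (hm : 0 < m)
    (hF : ContDiff ℝ 2 F) (hconv : Tendsto x atTop (𝓝 x')) {c : ℝ} (hc : 0 < c)
    (hB : ∀ᶠ k in atTop, ∀ j, ∀ v : Vec n, c * ‖v‖ ^ 2 ≤ v.ofLp ⬝ᵥ (B k j *ᵥ v.ofLp))
    (hDM : ∀ ε > 0, ∀ᶠ k in atTop, ∀ j,
      ‖WithLp.toLp 2 (B k j *ᵥ (d k).ofLp) - hess F j x' (d k)‖ ≤ ε * ‖d k‖) :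
    ∀ᶠ k in atTop, Wolfe F ρ σ (x k) (d k) 1 := by
  have hd := hrun.tendsto_dir_zero hm hF hconv hc hB
  have hρ : 0 < 1 / 2 - ρ := sub_pos.2 hrun.rho_lt
  have hσ : 0 < σ := hrun.rho_pos.trans hrun.rho_lt_sigma
  obtain ⟨ε, hε, hε1, hε2⟩ : ∃ ε > 0, 2 * ε ≤ (1 / 2 - ρ) * c ∧ 2 * ε ≤ σ * c :=
    ⟨min ((1 / 2 - ρ) * c / 2) (σ * c / 2), by positivity,
      by linarith [min_le_left ((1 / 2 - ρ) * c / 2) (σ * c / 2)],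
      by linarith [min_le_right ((1 / 2 - ρ) * c / 2) (σ * c / 2)]⟩
  filter_upwards [hB, hDM ε hε, eventually_unit_step_expansion hF hconv hd hε]
    with k hBk hDMk hk
  have hHk := hrun.isHermitian hm hF k
  have hD := maxDirDeriv_le_neg hm hHk (hrun.direction k) fun j => hBk j (d k)
  have hmod := two_mul_qnModel_le_maxDirDeriv hm hHk (hrun.direction k)
  have hquad : ∀ j, |(d k).ofLp ⬝ᵥ (B k j *ᵥ (d k).ofLp) - inner ℝ (hess F j x' (d k)) (d k)|
      ≤ ε * ‖d k‖ ^ 2 := fun j =>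
    inner_hess_sub_le (by rw [inner_eq_dotProduct, dotProduct_comm]) (hDMk j)
  have hsq := sq_nonneg ‖d k‖
  have hρ0 := hrun.rho_pos
  rw [Wolfe, one_smul]
  constructor
  · intro j
    have h1 := (abs_le.1 (hk j).2).2
    have h2 := (abs_le.1 (hquad j)).1
    have h3 := qnPiece_le_qnModel (F := F) (B := B k) (x := x k) (d := d k) j
    rw [qnPiece] at h3
    have h4 := mul_le_mul_of_nonneg_right hε1 hsq
    have h5 := mul_le_mul_of_nonneg_left hD hρ.le
    linarith [mul_nonneg hε.le hsq]
  -- The `w`-average of `∇F_jᵀ d + dᵀ B_j d` vanishes, so `𝒟` at the trial point is at least `-2 ε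
  -- ‖d‖²`.
  · obtain ⟨w, hw, h0, h1⟩ := exists_multiplier hm hHk (hrun.direction k)
    obtain ⟨h2, h3⟩ := two_mul_qnModel_eq h0 h1
    have h4 : ∀ j, inner ℝ (grad F j (x k)) (d k) + (d k).ofLp ⬝ᵥ (B k j *ᵥ (d k).ofLp)
        ≤ maxDirDeriv F (x k + d k) (d k) + 2 * ε * ‖d k‖ ^ 2 := fun j => by
      have h5 := inner_le_maxDirDeriv (F := F) (x := x k + d k) (d := d k) j
      have h6 : |inner ℝ (grad F j (x k + d k)) (d k) - inner ℝ (grad F j (x k)) (d k)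
          - inner ℝ (hess F j x' (d k)) (d k)| ≤ ε * ‖d k‖ ^ 2 :=
        inner_hess_sub_le (inner_sub_left _ _ _) (hk j).1
      linarith [(abs_le.1 h6).1, (abs_le.1 (hquad j)).2]
    have h7 := sum_mul_le_of_stdSimplex hw h4
    simp only [mul_add, Finset.sum_add_distrib] at h7
    have h8 := mul_le_mul_of_nonneg_right hε2 hsq
    have h9 := mul_le_mul_of_nonneg_left hD hσ.le
    linarith

lemma IsRun.eventually_norm_dir_succ_le (hrun : IsRun F ρ σ ϑlo ϑhi x d α μ ϑ B) (hm : 0 < m)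
    (hF : ContDiff ℝ 2 F) (hconv : Tendsto x atTop (𝓝 x')) {c : ℝ} (hc : 0 < c)
    (hB : ∀ᶠ k in atTop, ∀ j, ∀ v : Vec n, c * ‖v‖ ^ 2 ≤ v.ofLp ⬝ᵥ (B k j *ᵥ v.ofLp))
    (hDM : ∀ ε > 0, ∀ᶠ k in atTop, ∀ j,
      ‖WithLp.toLp 2 (B k j *ᵥ (d k).ofLp) - hess F j x' (d k)‖ ≤ ε * ‖d k‖)
    (hunit : ∀ᶠ k in atTop, x (k + 1) = x k + d k) {ε : ℝ} (hε : 0 < ε) :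
    ∀ᶠ k in atTop, ‖d (k + 1)‖ ≤ ε * ‖d k‖ := by
  have hd := hrun.tendsto_dir_zero hm hF hconv hc hB
  have hε' : 0 < c * ε / 4 := by positivity
  filter_upwards [(tendsto_add_atTop_nat 1).eventually hB, hDM _ hε', hunit,
    eventually_unit_step_expansion hF hconv hd hε'] with k hBk hDMk huk hk
  -- The multipliers of iteration `k` are reused to test the subproblem at `k + 1`, whose value is
  -- at most its value 0 at the zero direction.
  obtain ⟨w, hw, h0, -⟩ := exists_multiplier hm (hrun.isHermitian hm hF k) (hrun.direction k)
  have h1 : ‖∑ j, w j • grad F j (x (k + 1))‖ ≤ c * ε / 2 * ‖d k‖ := by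
    have h2 : ∑ j, w j • grad F j (x (k + 1)) = ∑ j, w j • (grad F j (x k + d k)
        - (grad F j (x k) + WithLp.toLp 2 (B k j *ᵥ (d k).ofLp))) := by
      simp only [smul_sub, Finset.sum_sub_distrib, h0, sub_zero, huk]
    rw [h2]
    refine norm_sum_smul_le_of_stdSimplex hw fun j => ?_
    have h3 : grad F j (x k + d k) - (grad F j (x k) + WithLp.toLp 2 (B k j *ᵥ (d k).ofLp)) =
        (grad F j (x k + d k) - grad F j (x k) - hess F j x' (d k))
        - (WithLp.toLp 2 (B k j *ᵥ (d k).ofLp) - hess F j x' (d k)) := by abel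
    rw [h3]
    refine (norm_sub_le _ _).trans ?_
    linarith [(hk j).1, hDMk j]
  have h4 : ∑ j, w j * qnPiece F (B (k + 1)) (x (k + 1)) j (d (k + 1)) ≤ 0 := by
    refine sum_mul_le_of_stdSimplex hw fun j => (qnPiece_le_qnModel j).trans ?_
    have h5 : qnModel F (B (k + 1)) (x (k + 1)) (d (k + 1)) ≤
      qnModel F (B (k + 1)) (x (k + 1)) 0 := hrun.direction (k + 1) (Set.mem_univ _)
    refine h5.trans_eq ?_
    obtain ⟨j, hj⟩ := exists_qnPiece_eq_qnModel hm F (B (k + 1)) (x (k + 1)) 0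
    rw [← hj, qnPiece]
    simp
  have h6 : inner ℝ (∑ j, w j • grad F j (x (k + 1))) (d (k + 1)) + c / 2 * ‖d (k + 1)‖ ^ 2 ≤
      ∑ j, w j * qnPiece F (B (k + 1)) (x (k + 1)) j (d (k + 1)) := by
    have h7 := le_sum_mul_of_stdSimplex hw fun j => hBk j (d (k + 1))
    simp only [qnPiece, mul_add, Finset.sum_add_distrib, sum_inner, real_inner_smul_left,
      mul_left_comm _ (1 / 2 : ℝ), ← Finset.mul_sum]
    linarith
  have h8 := (abs_le.1 (abs_real_inner_le_norm (∑ j, w j • grad F j (x (k + 1)))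
    (d (k + 1)))).1
  have h9 := mul_le_mul_of_nonneg_right h1 (norm_nonneg (d (k + 1)))
  have hd1 : 0 < ‖d (k + 1)‖ := norm_pos_iff.2 (hrun.dir_ne_zero hm hF (k + 1))
  have h10 : (c / 2 * ‖d (k + 1)‖) * ‖d (k + 1)‖ ≤ (c / 2 * (ε * ‖d k‖)) * ‖d (k + 1)‖ := by
    linarith
  exact le_of_mul_le_mul_left (le_of_mul_le_mul_right h10 hd1) (by positivity)

/-- Summing directions that at least halve gives `‖x k - x'‖ ≤ 2 ‖d k‖`, while `‖d k‖` is at most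
the sum of two consecutive errors. -/
lemma tendsto_ratio_of_norm_dir_succ_le (hconv : Tendsto x atTop (𝓝 x'))
    (hunit : ∀ᶠ k in atTop, x (k + 1) = x k + d k)
    (h : ∀ ε > 0, ∀ᶠ k in atTop, ‖d (k + 1)‖ ≤ ε * ‖d k‖) :
    Tendsto (fun k => ‖x (k + 1) - x'‖ / ‖x k - x'‖) atTop (𝓝 0) := by
  obtain ⟨N, hN⟩ := eventually_atTop.1 (hunit.and (h (1 / 2) (by norm_num)))
  have hgeom : ∀ k ≥ N, ∀ i, ‖d (k + i)‖ ≤ ‖d k‖ / 2 ^ i := fun k hk i => by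
    induction i with
    | zero => simp
    | succ i ih =>
      refine (hN (k + i) (by omega)).2.trans ?_
      calc 1 / 2 * ‖d (k + i)‖ ≤ 1 / 2 * (‖d k‖ / 2 ^ i) := by gcongr
        _ = _ := by rw [pow_succ]; field_simp
  have hdist : ∀ k ≥ N, ‖x k - x'‖ ≤ 2 * ‖d k‖ := fun k hk => by
    have hlim : Tendsto (fun i => x (k + i)) atTop (𝓝 x') :=
      hconv.comp (tendsto_add_atTop_nat k |>.congr fun i => add_comm _ _)
    have h1 := dist_le_of_le_geometric_two_of_tendsto₀ (C := 2 * ‖d k‖) (fun i => by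
      have h2 := (hN (k + i) (by omega)).1
      rw [← add_assoc, h2, dist_eq_norm, sub_add_cancel_left, norm_neg]
      refine (hgeom k hk i).trans_eq (by ring)) hlim
    rwa [add_zero, dist_eq_norm] at h1
  rw [Metric.tendsto_nhds]
  intro ε hε
  -- `δ ≤ 1/4` lets the next error, occurring on the right with factor `2 δ`, be absorbed on the
  -- left, which doubles the constant to `4 δ`.
  obtain ⟨δ, hδ, hδ1, hδ2⟩ : ∃ δ > 0, δ ≤ 1 / 4 ∧ 4 * δ < ε :=
    ⟨min (1 / 4) (ε / 8), by positivity, min_le_left _ _,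
      by linarith [min_le_right (1 / 4) (ε / 8)]⟩
  filter_upwards [h δ hδ, eventually_ge_atTop N] with k hk hkN
  have h1 := hdist (k + 1) (by omega)
  have h2 : ‖d k‖ ≤ ‖x k - x'‖ + ‖x (k + 1) - x'‖ := by
    have h3 : d k = (x (k + 1) - x') - (x k - x') := by rw [(hN k hkN).1]; abel
    rw [h3]
    exact (norm_sub_le _ _).trans_eq (add_comm _ _)
  have h4 : ‖x (k + 1) - x'‖ ≤ 4 * δ * ‖x k - x'‖ := by
    have h5 := mul_le_mul_of_nonneg_left h2 hδ.le
    have h6 := mul_le_mul_of_nonneg_right hδ1 (norm_nonneg (x (k + 1) - x'))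
    linarith
  rw [Real.dist_eq, sub_zero, abs_of_nonneg (by positivity)]
  exact (div_le_of_le_mul₀ (norm_nonneg _) (by positivity) h4).trans_lt hδ2

end SuperlinearRate

end MOBFGS

end

theorem mainTheorem3 {n m : ℕ} (hm : 0 < m)
    (F : MOBFGS.Vec n → MOBFGS.Vec m)
    (ρ σ ϑlo ϑhi : ℝ) (x d : ℕ → MOBFGS.Vec n) (α : ℕ → ℝ)
    (μ : ℕ → Fin m → ℝ) (ϑ : ℕ → ℝ) (B : ℕ → Fin m → Matrix (Fin n) (Fin n) ℝ)
    (hrun : MOBFGS.IsRun F ρ σ ϑlo ϑhi x d α μ ϑ B)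
    (xstar : MOBFGS.Vec n)
    (hF : ContDiff ℝ 2 F)
    (hconv : Filter.Tendsto x Filter.atTop (nhds xstar))
    (hopt : MOBFGS.LocalParetoOptimal F xstar)
    (hpos : ∀ j, ∀ z : MOBFGS.Vec n, z ≠ 0 → 0 < inner ℝ z (MOBFGS.hess F j xstar z))
    (hholder : ∃ ν M : ℝ, 0 < ν ∧ ν ≤ 1 ∧ 0 < M ∧ ∀ᶠ y in nhds xstar, ∀ j,
      ‖MOBFGS.hess F j y - MOBFGS.hess F j xstar‖ ≤ M * ‖y - xstar‖ ^ ν)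
    (hsum : ∀ j, Summable fun k => MOBFGS.corr F (μ k) (ϑ k) j (x k) (x (k + 1))) :
    (∀ᶠ k in Filter.atTop, MOBFGS.Wolfe F ρ σ (x k) (d k) 1) ∧
      MOBFGS.ConvergesSuperlinearly x xstar := by
  obtain ⟨ν, M, hν, -, hM, hhol⟩ := hholder
  have hG : ∀ j, (MOBFGS.hessMatrix F j xstar).PosDef := fun j =>
    MOBFGS.hessMatrix_posDef hF (hpos j)
  obtain ⟨e, he, he0, hdev⟩ := hrun.exists_summable_deviation hm hF hconv hpos hν hM hhol hsum
  obtain ⟨⟨K, hK⟩, hgain⟩ := hrun.exists_potential_bound hm hF hG he he0 hdev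
  obtain ⟨c, hc, hB⟩ := hrun.exists_matrix_lower_bound hm hF hG hK
  have hDM := fun (ε : ℝ) (hε : ε > 0) => hrun.eventually_dennisMore hm hF hG hgain hε
  have hwolfe := hrun.eventually_wolfe_one hm hF hconv hc hB hDM
  have hunit : ∀ᶠ k in Filter.atTop, x (k + 1) = x k + d k := by
    filter_upwards [hwolfe] with k hk
    rw [hrun.next_iterate, hrun.unit_first k hk, one_smul]
  exact ⟨hwolfe, hconv, hrun.ne_limit hm hF hconv,
    MOBFGS.tendsto_ratio_of_norm_dir_succ_le hconv hunit fun ε hε =>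
      hrun.eventually_norm_dir_succ_le hm hF hconv hc hB hDM hunit hε⟩
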